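/- Let $n\ge 1$, $1<p<\infty$, and let $r,s\in(0,\infty]$ satisfy $$\tfrac12-\tfrac1p\le\tfrac1r\le 1-\tfrac1p,\qquad -\tfrac12+\tfrac1p\le\tfrac1s\le\tfrac1p,\qquad \tfrac1r+\tfrac1s<\tfrac2n$$ (with $1/\infty=0$). Let $a\in L_r(\mathbb R^n)$ and $b\in L_s(\mathbb R^n)$ be complex-valued and put $q=ab$. Let $H_0=-\Delta$ in $L_p(\mathbb R^n)$ with domain the Sobolev space $W^2_p(\mathbb R^n)$, let $A,B$ be the operators of multiplication by $a,b$ in $L_p(\mathbb R^n)$ with maximal domains, and write $R(z;H_0)=(H_0-z)^{-1}$. Call $z\in\mathbb C\setminus[0,\infty)$, a regular point of $H_0$, admissible if $B\,R(z;H_0)$ is bounded and everywhere defined, $R(z;H_0)A$ and $B\,R(z;H_0)A$ have closures $[R(z;H_0)A]$ and $Q(z)$ that are bounded and everywhere defined, and $1+Q(z)$ is bijective. Let $H$ be the Schrödinger operator $-\Delta+q$ in $L_p(\mathbb R^n)$ defined by this factorization, i.e. the closed extension $H$ of $H_0+AB$ such that, for some admissible $z$, $$(H-z)^{-1}=R(z;H_0)-[R(z;H_0)A]\,(1+Q(z))^{-1}\,B\,R(z;H_0).$$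 Then every eigenvalue $\lambda$ of $H$ with $\operatorname{Re}\lambda<0$ satisfies the following. (i) If $r,s$ are not both $\infty$, then with $\alpha=(1/r+1/s)^{-1}$, $$|\operatorname{Re}\lambda|^{\alpha-n/2}\le(4\pi)^{-n/2}\,\frac{\Gamma(\alpha-n/2)}{\Gamma(\alpha)}\,\|a\|_r^{\alpha}\,\|b\|_s^{\alpha}.$$ (ii) If $r=s=\infty$, then $|\operatorname{Re}\lambda|\le\|a\|_\infty\|b\|_\infty$. -/

import Mathlib

open MeasureTheory
open scoped ENNReal LineDeriv Laplacian SchwartzMap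

/-- `L_p(ℝⁿ)`, complex valued, with respect to Lebesgue measure. -/
abbrev LpRn (n : ℕ) (p : ℝ≥0∞) : Type :=
  Lp ℂ p (volume : Measure (EuclideanSpace ℝ (Fin n)))

namespace Schrodinger

section Operators

variable {E : Type*} [NormedAddCommGroup E] [NormedSpace ℂ E]

/-- The product `S T` of two unbounded operators, on its natural domain
`{x ∈ D(T) : T x ∈ D(S)}`. -/
noncomputable def prodOp (S T : E →ₗ.[ℂ] E) : E →ₗ.[ℂ] E :=
  S.comp (T.domRestrict ((S.domain.comap T.toFun).map T.domain.subtype)) (by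
    rintro ⟨x, hx, hx'⟩
    obtain ⟨y, hy, rfl⟩ := hx
    exact hy)

theorem mem_graph_prodOp (S T : E →ₗ.[ℂ] E) (x z : E) :
    (x, z) ∈ (prodOp S T).graph ↔ ∃ y, (x, y) ∈ T.graph ∧ (y, z) ∈ S.graph := by
  constructor
  · intro h
    obtain ⟨⟨w, hw⟩, rfl, rfl⟩ := (LinearPMap.mem_graph_iff _).1 h
    obtain ⟨h1, h2⟩ := hw
    obtain ⟨y, hy, rfl⟩ := h1
    exact ⟨T y, T.mem_graph y, S.mem_graph ⟨T y, hy⟩⟩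
  · rintro ⟨y, h1, h2⟩
    obtain ⟨x', rfl, rfl⟩ := (LinearPMap.mem_graph_iff _).1 h1
    obtain ⟨y', hy, rfl⟩ := (LinearPMap.mem_graph_iff _).1 h2
    have hx : T x' ∈ S.domain := by
      have h := y'.2
      rwa [hy] at h
    have hdom : (x' : E) ∈ (prodOp S T).domain := ⟨⟨x', hx, rfl⟩, x'.2⟩
    refine (LinearPMap.mem_graph_iff _).2 ⟨⟨x', hdom⟩, rfl, ?_⟩
    have : (⟨T x', hx⟩ : S.domain) = y' := Subtype.ext hy.symm
    rw [← this]
    rfl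

/-- Multiplication by the scalar `z`, as an everywhere defined operator. -/
noncomputable def scalarOp (z : ℂ) : E →ₗ.[ℂ] E :=
  (z • (LinearMap.id : E →ₗ[ℂ] E)).toPMap ⊤

/-- `T` is a bounded operator defined on the whole space. -/
def IsBoundedOp (T : E →ₗ.[ℂ] E) : Prop :=
  T.domain = ⊤ ∧ Continuous (fun x : T.domain => T x)

/-- The operator `T` has trivial kernel and range the whole space. -/
def IsBijectiveOp (T : E →ₗ.[ℂ] E) : Prop :=
  Function.Bijective (fun x : T.domain => T x)

/-- The resolvent `R(z; T) = (T - z I)⁻¹`, with domain the range of `T - z I`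
(meaningful when `T - z I` is injective). -/
noncomputable def resolventOp (T : E →ₗ.[ℂ] E) (z : ℂ) : E →ₗ.[ℂ] E :=
  (T - scalarOp z).inverse

/-- `z` is a regular point of `T`: the operator `T - z I` is a bijection from the domain of `T`
onto the whole space, with bounded inverse. -/
def IsRegularPoint (T : E →ₗ.[ℂ] E) (z : ℂ) : Prop :=
  IsBijectiveOp (T - scalarOp z) ∧ IsBoundedOp (resolventOp T z)

/-- `z` is an eigenvalue of the unbounded operator `T`. -/
def IsEigenvalue (T : E →ₗ.[ℂ] E) (z : ℂ) : Prop :=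
  ∃ u : T.domain, (u : E) ≠ 0 ∧ T u = z • (u : E)

end Operators

section Concrete

variable {n : ℕ} (p : ℝ≥0∞)

/-- The graph of multiplication by `a` with maximal domain: the pairs `(u, f)` in `L_p × L_p` with
`f = a u` almost everywhere. -/
def mulGraph (a : EuclideanSpace ℝ (Fin n) → ℂ) : Submodule ℂ (LpRn n p × LpRn n p) where
  carrier := {w | w.2 =ᵐ[volume] fun x => a x * w.1 x}
  zero_mem' := by
    change ((0 : LpRn n p) : EuclideanSpace ℝ (Fin n) → ℂ) =ᵐ[volume]
      fun x => a x * (0 : LpRn n p) x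
    filter_upwards [Lp.coeFn_zero ℂ p (volume : Measure (EuclideanSpace ℝ (Fin n)))] with x hx
    rw [hx]
    simp
  add_mem' := by
    rintro ⟨u, f⟩ ⟨v, g⟩ hu hv
    change ((f + g : LpRn n p) : EuclideanSpace ℝ (Fin n) → ℂ) =ᵐ[volume]
      fun x => a x * (u + v : LpRn n p) x
    filter_upwards [Lp.coeFn_add u v, Lp.coeFn_add f g, hu, hv] with x h1 h2 h3 h4
    rw [h1, h2, Pi.add_apply, Pi.add_apply, h3, h4, mul_add]
  smul_mem' := by
    rintro c ⟨u, f⟩ hu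
    change ((c • f : LpRn n p) : EuclideanSpace ℝ (Fin n) → ℂ) =ᵐ[volume]
      fun x => a x * (c • u : LpRn n p) x
    filter_upwards [Lp.coeFn_smul c u, Lp.coeFn_smul c f, hu] with x h1 h2 h3
    rw [h1, h2, Pi.smul_apply, Pi.smul_apply, h3, smul_eq_mul, smul_eq_mul, mul_left_comm]

/-- The operator of multiplication by `a` in `L_p(ℝⁿ)`, with its maximal domain
`{u ∈ L_p : a u ∈ L_p}`. -/
noncomputable def mulOp (a : EuclideanSpace ℝ (Fin n) → ℂ) : LpRn n p →ₗ.[ℂ] LpRn n p :=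
  (mulGraph p a).toLinearPMap

theorem mem_graph_mulOp (a : EuclideanSpace ℝ (Fin n) → ℂ) (u f : LpRn n p) :
    (u, f) ∈ (mulOp p a).graph ↔ f =ᵐ[volume] fun x => a x * u x := by
  rw [mulOp, Submodule.toLinearPMap_graph_eq]
  · rfl
  · rintro ⟨u, f⟩ h (rfl : u = 0)
    change f = 0
    rw [Lp.eq_zero_iff_ae_eq_zero]
    have h' : f =ᵐ[volume] fun x => a x * (0 : LpRn n p) x := h
    filter_upwards [h', Lp.coeFn_zero ℂ p (volume : Measure (EuclideanSpace ℝ (Fin n)))]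
      with x h1 h2
    rw [h1, h2]
    simp

variable [Fact (1 ≤ p)]

/-- The embedding of `L_p(ℝⁿ)` into the tempered distributions. -/
noncomputable def toDistr :
    LpRn n p →L[ℂ] 𝓢'(EuclideanSpace ℝ (Fin n), ℂ) :=
  Lp.toTemperedDistributionCLM ℂ (volume : Measure (EuclideanSpace ℝ (Fin n))) p

/-- The Sobolev space `W_p^2(ℝⁿ)`: the `u ∈ L_p` whose distributional partial derivatives of
orders one and two all belong to `L_p`. -/
def IsW2 (u : LpRn n p) : Prop :=
  (∀ i : Fin n, ∃ g : LpRn n p, ∂_{EuclideanSpace.single i (1 : ℝ)} (toDistr p u) = toDistr p g) ∧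
  (∀ i j : Fin n, ∃ g : LpRn n p,
    ∂_{EuclideanSpace.single i (1 : ℝ)} (∂_{EuclideanSpace.single j (1 : ℝ)} (toDistr p u))
      = toDistr p g)

/-- The graph of `-Δ` on `W_p^2(ℝⁿ)`. -/
noncomputable def freeGraph : Submodule ℂ (LpRn n p × LpRn n p) where
  carrier := {w | IsW2 p w.1 ∧ toDistr p w.2 = -Δ (toDistr p w.1)}
  zero_mem' := by
    refine ⟨⟨fun i => ⟨0, ?_⟩, fun i j => ⟨0, ?_⟩⟩, ?_⟩
    · simp [LineDeriv.lineDerivOp_zero]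
    · simp [LineDeriv.lineDerivOp_zero]
    · simp [← TemperedDistribution.laplacianCLM_apply]
  add_mem' := by
    rintro ⟨u, f⟩ ⟨v, g⟩ ⟨⟨hu1, hu2⟩, hu⟩ ⟨⟨hv1, hv2⟩, hv⟩
    refine ⟨⟨fun i => ?_, fun i j => ?_⟩, ?_⟩
    · obtain ⟨k, hk⟩ := hu1 i
      obtain ⟨l, hl⟩ := hv1 i
      refine ⟨k + l, ?_⟩
      simp only [Prod.mk_add_mk, map_add, LineDeriv.lineDerivOp_add] at *
      rw [hk, hl]
    · obtain ⟨k, hk⟩ := hu2 i j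
      obtain ⟨l, hl⟩ := hv2 i j
      refine ⟨k + l, ?_⟩
      simp only [Prod.mk_add_mk, map_add, LineDeriv.lineDerivOp_add] at *
      rw [hk, hl]
    · simp only [Prod.mk_add_mk, map_add, ← TemperedDistribution.laplacianCLM_apply] at *
      rw [hu, hv, neg_add]
  smul_mem' := by
    rintro c ⟨u, f⟩ ⟨⟨hu1, hu2⟩, hu⟩
    refine ⟨⟨fun i => ?_, fun i j => ?_⟩, ?_⟩
    · obtain ⟨k, hk⟩ := hu1 i
      refine ⟨c • k, ?_⟩
      simp only [Prod.smul_mk, map_smul, LineDeriv.lineDerivOp_smul] at *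
      rw [hk]
    · obtain ⟨k, hk⟩ := hu2 i j
      refine ⟨c • k, ?_⟩
      simp only [Prod.smul_mk, map_smul, LineDeriv.lineDerivOp_smul] at *
      rw [hk]
    · simp only [Prod.smul_mk, map_smul, ← TemperedDistribution.laplacianCLM_apply] at *
      rw [hu, smul_neg]

/-- The unperturbed operator `H₀ = -Δ` in `L_p(ℝⁿ)`, with domain `W_p^2(ℝⁿ)`. -/
noncomputable def freeOp : LpRn n p →ₗ.[ℂ] LpRn n p := (freeGraph p).toLinearPMap

theorem mem_graph_freeOp (u f : LpRn n p) :
    (u, f) ∈ (freeOp p).graph ↔ IsW2 p u ∧ toDistr p f = -Δ (toDistr p u) := by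
  rw [freeOp, Submodule.toLinearPMap_graph_eq]
  · rfl
  · rintro ⟨u, f⟩ ⟨-, h⟩ (rfl : u = 0)
    have h0 : toDistr p f = 0 := by simpa [← TemperedDistribution.laplacianCLM_apply] using h
    have hker := Lp.ker_toTemperedDistributionCLM_eq_bot (F := ℂ)
      (μ := (volume : Measure (EuclideanSpace ℝ (Fin n)))) (p := p)
    have : f ∈ (⊥ : Submodule ℂ (LpRn n p)) := hker ▸ h0
    simpa using this

variable (a b : EuclideanSpace ℝ (Fin n) → ℂ) (z : ℂ)

/-- The closure of `R(z; H₀) A`. -/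
noncomputable def leftOp : LpRn n p →ₗ.[ℂ] LpRn n p :=
  (prodOp (resolventOp (freeOp p) z) (mulOp p a)).closure

/-- The operator `B R(z; H₀)`. -/
noncomputable def rightOp : LpRn n p →ₗ.[ℂ] LpRn n p :=
  prodOp (mulOp p b) (resolventOp (freeOp p) z)

/-- The closure `Q(z)` of the bordered resolvent `B R(z; H₀) A`. -/
noncomputable def borderedOp : LpRn n p →ₗ.[ℂ] LpRn n p :=
  (prodOp (rightOp p b z) (mulOp p a)).closure

/-- The operator
`R(z; H₀) - [R(z; H₀) A] (1 + Q(z))⁻¹ B R(z; H₀)`, where `[ ]` is the closure: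
the resolvent at `z` of the perturbed operator. -/
noncomputable def perturbedResolvent : LpRn n p →ₗ.[ℂ] LpRn n p :=
  resolventOp (freeOp p) z -
    prodOp (leftOp p a z) (prodOp (scalarOp 1 + borderedOp p a b z).inverse (rightOp p b z))

/-- The construction of the perturbed operator is possible at the point `z`: `z` lies in
`ℂ ∖ [0, ∞)` and is a regular point of `H₀`, the operators `[R(z; H₀) A]`, `B R(z; H₀)` and `Q(z)`
are bounded and defined on the whole space, and `1 + Q(z)` is bijective. -/
structure IsAdmissible : Prop where
  notMem : z ∉ Complex.ofReal '' Set.Ici 0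
  regular : IsRegularPoint (freeOp (n := n) p) z
  left : IsBoundedOp (leftOp p a z)
  right : IsBoundedOp (rightOp p b z)
  bordered : IsBoundedOp (borderedOp p a b z)
  bijective : IsBijectiveOp (scalarOp 1 + borderedOp p a b z)

/-- `H` is the Schrödinger operator `-Δ + a b` realized in `L_p(ℝⁿ)` by means of the factorization:
the closed extension of `H₀ + A B` whose resolvent at some (equivalently, every) admissible
point `z` is `R(z; H₀) - [R(z; H₀) A] (1 + Q(z))⁻¹ B R(z; H₀)`. -/
def IsSchrodingerOp (H : LpRn n p →ₗ.[ℂ] LpRn n p) : Prop :=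
  ∃ z : ℂ, IsAdmissible p a b z ∧ H = (perturbedResolvent p a b z).inverse + scalarOp z

end Concrete

end Schrodinger

/-! Let `u` be an eigenfunction for `μ` and put `v = b u`. The factorized resolvent formula at one
admissible `z` shows that `v` lies in `L_p` and that `(-Δ - μ) u = -a v` as tempered distributions.
Since `Re μ < 0`, Fourier transformation turns this into division by `4π²|ξ|² - μ`, so `u` is
recovered from `v` by multiplying by `a`, transforming, multiplying by the symbol `m = (4π²|ξ|² -
μ)⁻¹`, and transforming back. Neither admissibility of `μ` itself nor an operator `Q(μ)` is needed.

Each step has an `L`-space bound. Hölder puts `a v` in `L_t` with `1/t = 1/r + 1/p`; Hausdorff–Young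
passes to `L_t'`; the symbol in `L_α` leads to `L_q` with `1/q = 1 - (1/p - 1/s)`; Hausdorff–Young
again gives `L_e` with `1/e = 1/p - 1/s`; multiplication by `b` returns to `L_p`. The inequalities
on `r` and `s` say that these exponents are legitimate and that `t, q ≤ 2`. Going once around gives
`‖v‖ ≤ ‖b‖_s ‖m‖_α ‖a‖_r ‖v‖` with `v ≠ 0`, hence `1 ≤ ‖m‖_α ‖a‖_r ‖b‖_s`. The bound `|m| ≤ (4π²|ξ|²
+ |Re μ|)⁻¹` and a Gamma integral, or a supremum when `r = s = ∞`, finish.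

The carrying lemmas are `exists_fourier_eq_toTemperedDistribution` (Hausdorff–Young),
`lintegral_mul_sq_norm_add_rpow_neg` (the integral), `IsSchrodingerOp.exists_eigenfunction` (the
equation) and `IsSchrodingerOp.one_le_of_isEigenvalue` (the loop). -/

/-! ### Riesz–Thorin interpolation in finite dimensions -/

section FiniteInterpolation

open Complex

/-- Finite-dimensional **Riesz–Thorin interpolation** between `ℓ¹ × ℓ¹` and `ℓ² × ℓ²` bounds for a
bilinear form on weighted spaces. -/
theorem norm_bilin_le_of_endpoint_bounds {ι κ : Type*} (s : Finset ι) (s' : Finset κ)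
    (w : ι → ℝ) (v : κ → ℝ) (β : ι → κ → ℂ)
    (h1 : ∀ (x : ι → ℂ) (y : κ → ℂ), ‖∑ i ∈ s, ∑ j ∈ s', x i * y j * β i j‖ ≤
      (∑ i ∈ s, w i * ‖x i‖) * ∑ j ∈ s', v j * ‖y j‖)
    (h2 : ∀ (x : ι → ℂ) (y : κ → ℂ), ‖∑ i ∈ s, ∑ j ∈ s', x i * y j * β i j‖ ≤
      (∑ i ∈ s, w i * ‖x i‖ ^ (2 : ℝ)) ^ (2⁻¹ : ℝ) * (∑ j ∈ s', v j * ‖y j‖ ^ (2 : ℝ)) ^ (2⁻¹ : ℝ))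
    (hw : ∀ i, 0 ≤ w i) (hv : ∀ j, 0 ≤ v j) {t : ℝ} (ht1 : 1 ≤ t) (ht2 : t ≤ 2)
    (x : ι → ℂ) (y : κ → ℂ) :
    ‖∑ i ∈ s, ∑ j ∈ s', x i * y j * β i j‖ ≤
      (∑ i ∈ s, w i * ‖x i‖ ^ t) ^ t⁻¹ * (∑ j ∈ s', v j * ‖y j‖ ^ t) ^ t⁻¹ := by
  have ht0 : 0 < t := by linarith
  -- The analytic family through `c`: the phase is kept and the modulus is `‖c‖ ^ t` on `Re z = 0`
  -- and `‖c‖ ^ (t / 2)` on `Re z = 1`, so both endpoint bounds are expressed by the same sums `X`,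
  -- `Y`.
  set P : ℂ → ℂ → ℂ := fun c z => c / ‖c‖ * (‖c‖ : ℂ) ^ ((t : ℂ) * (1 - z / 2)) with hP
  have hPn : ∀ c z, c ≠ 0 → ‖P c z‖ = ‖c‖ ^ (t * (1 - z.re / 2)) := by
    intro c z hc
    have hc' : 0 < ‖c‖ := norm_pos_iff.2 hc
    rw [hP]
    simp only [norm_mul, norm_div, norm_real, norm_norm, div_self hc'.ne', one_mul]
    rw [norm_cpow_eq_rpow_re_of_pos hc']
    simp
  have hP0 : ∀ z, P 0 z = 0 := by intro z; simp [hP]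
  have hPre0 : ∀ c z, z.re = 0 → ‖P c z‖ = ‖c‖ ^ t := by
    intro c z hz
    rcases eq_or_ne c 0 with rfl | hc
    · simp [hP0, ht0.ne']
    · rw [hPn c z hc, hz]; simp
  have hPre1 : ∀ c z, z.re = 1 → ‖P c z‖ ^ (2 : ℝ) = ‖c‖ ^ t := by
    intro c z hz
    rcases eq_or_ne c 0 with rfl | hc
    · simp [hP0, ht0.ne']
    · rw [hPn c z hc, hz, ← Real.rpow_mul (norm_nonneg _)]
      congr 1; ring
  have hPb : ∀ c z, 0 ≤ z.re → z.re ≤ 1 → ‖P c z‖ ≤ 1 + ‖c‖ ^ t := by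
    intro c z hz0 hz1
    rcases eq_or_ne c 0 with rfl | hc
    · simp [hP0, ht0.ne']
    · rw [hPn c z hc]
      have hc' : 0 < ‖c‖ := norm_pos_iff.2 hc
      rcases le_total ‖c‖ 1 with h | h
      · have := Real.rpow_le_one hc'.le h (z := t * (1 - z.re / 2)) (by
          apply mul_nonneg ht0.le; linarith)
        have h3 := Real.rpow_nonneg hc'.le t
        linarith
      · have := Real.rpow_le_rpow_of_exponent_le h (y := t * (1 - z.re / 2)) (z := t) (by nlinarith)
        linarith
  have hPd : ∀ c, Differentiable ℂ (P c) := by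
    intro c
    rcases eq_or_ne c 0 with rfl | hc
    · have : P 0 = fun _ => 0 := funext hP0
      rw [this]; fun_prop
    · have hc' : (‖c‖ : ℂ) ≠ 0 := by simpa using hc
      intro z
      apply DifferentiableAt.const_mul
      exact DifferentiableAt.const_cpow (by fun_prop) (Or.inl hc')
  set Φ : ℂ → ℂ := fun z => ∑ i ∈ s, ∑ j ∈ s', P (x i) z * P (y j) z * β i j with hΦ
  have hΦd : Differentiable ℂ Φ := by
    intro z
    apply DifferentiableAt.fun_sum; intro i _
    apply DifferentiableAt.fun_sum; intro j _
    exact ((hPd _ z).mul (hPd _ z)).mul_const _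
  set X := ∑ i ∈ s, w i * ‖x i‖ ^ t
  set Y := ∑ j ∈ s', v j * ‖y j‖ ^ t
  have hX : 0 ≤ X := Finset.sum_nonneg fun i _ => mul_nonneg (hw i) (by positivity)
  have hY : 0 ≤ Y := Finset.sum_nonneg fun i _ => mul_nonneg (hv i) (by positivity)
  -- Solves `t (1 - θ / 2) = 1`, so that `P c θ = c`.
  set θ : ℝ := 2 * (1 - t⁻¹) with hθ
  have hti : t⁻¹ ≤ 1 := inv_le_one_of_one_le₀ ht1
  have hti' : 2⁻¹ ≤ t⁻¹ := by gcongr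
  have key := HadamardThreeLines.norm_le_interp_of_mem_verticalClosedStrip₀₁' Φ (z := θ)
    (a := X * Y) (b := X ^ (2⁻¹ : ℝ) * Y ^ (2⁻¹ : ℝ))
    (by constructor <;> simp [hθ] <;> linarith) hΦd.diffContOnCl
    (by
      refine ⟨∑ i ∈ s, ∑ j ∈ s', (1 + ‖x i‖ ^ t) * (1 + ‖y j‖ ^ t) * ‖β i j‖, ?_⟩
      rintro _ ⟨z, ⟨hz0, hz1⟩, rfl⟩
      refine (norm_sum_le _ _).trans (Finset.sum_le_sum fun i _ => ?_)
      refine (norm_sum_le _ _).trans (Finset.sum_le_sum fun j _ => ?_)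
      rw [norm_mul, norm_mul]
      gcongr
      · exact hPb _ z hz0 hz1
      · exact hPb _ z hz0 hz1)
    (by
      intro z hz
      refine (h1 (fun i => P (x i) z) (fun j => P (y j) z)).trans_eq ?_
      simp only [hPre0 _ z hz]; rfl)
    (by
      intro z hz
      refine (h2 (fun i => P (x i) z) (fun j => P (y j) z)).trans_eq ?_
      simp only [hPre1 _ z hz]; rfl)
  have hPθ : ∀ c, P c θ = c := by
    intro c
    rcases eq_or_ne c 0 with rfl | hc
    · exact hP0 _
    · have hc' : (‖c‖ : ℂ) ≠ 0 := by simpa using hc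
      have : (t : ℂ) * (1 - (θ : ℂ) / 2) = 1 := by
        have : t * (1 - θ / 2) = 1 := by rw [hθ]; field_simp; ring
        exact_mod_cast this
      simp only [hP, this, cpow_one]
      field_simp
  have hΦθ : Φ θ = ∑ i ∈ s, ∑ j ∈ s', x i * y j * β i j := by simp only [hΦ, hPθ]
  rw [hΦθ] at key
  refine key.trans_eq ?_
  simp only [ofReal_re]
  rw [← Real.mul_rpow hX hY, ← Real.mul_rpow hX hY, ← Real.rpow_mul (by positivity)]
  -- Adding exponents needs a positive base; when `X * Y = 0` the convention `0 ^ 0 = 1` makes `θ =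
  -- 0` a case of its own.
  rcases eq_or_lt_of_le (mul_nonneg hX hY) with h | h
  · rw [← h]
    rcases eq_or_ne θ 0 with h0 | h0
    · have : t⁻¹ = 1 := by linarith
      simp [h0, this]
    · rw [Real.zero_rpow (x := 2⁻¹ * θ) (by positivity), mul_zero, Real.zero_rpow (by positivity)]
  · rw [← Real.rpow_add h]
    congr 1
    rw [hθ]; ring

end FiniteInterpolation

/-! ### The Fourier transform on integrable and square integrable functions -/

section FourierLp

open FourierTransform
open scoped ContDiff

variable {V : Type*} [NormedAddCommGroup V] [InnerProductSpace ℝ V] [FiniteDimensional ℝ V]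
  [MeasurableSpace V] [BorelSpace V]

theorem ae_eq_of_forall_integral_schwartz_smul_eq {f g : V → ℂ}
    (hf : LocallyIntegrable f) (hg : LocallyIntegrable g)
    (h : ∀ φ : 𝓢(V, ℂ), ∫ x, φ x • f x = ∫ x, φ x • g x) : f =ᵐ[volume] g := by
  refine ae_eq_of_integral_contDiff_smul_eq hf hg fun φ hφ hφc => ?_
  have h1 : HasCompactSupport (Complex.ofRealCLM ∘ φ) := hφc.comp_left rfl
  have h2 : ContDiff ℝ ∞ (Complex.ofRealCLM ∘ φ) := by fun_prop
  simpa using h (h1.toSchwartzMap h2)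

/-- The exponents may differ: this is what identifies the eigenfunction in `L_p` with the function
in `L_e` produced by Hausdorff–Young. -/
theorem Lp.ae_eq_of_toTemperedDistribution_eq {p q : ℝ≥0∞} [hp : Fact (1 ≤ p)] [hq : Fact (1 ≤ q)]
    {f : Lp ℂ p (volume : Measure V)} {g : Lp ℂ q (volume : Measure V)}
    (h : Lp.toTemperedDistribution f = Lp.toTemperedDistribution g) : f =ᵐ[volume] g := by
  refine ae_eq_of_forall_integral_schwartz_smul_eq ((Lp.memLp f).locallyIntegrable hp.out)
    ((Lp.memLp g).locallyIntegrable hq.out) fun φ => ?_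
  simpa using DFunLike.congr_fun h φ

theorem integral_fourier_schwartz_smul_eq (φ : 𝓢(V, ℂ)) {f : V → ℂ} (hf : Integrable f) :
    ∫ x, (𝓕 φ) x • f x = ∫ ξ, φ ξ • 𝓕 f ξ := by
  simpa using! VectorFourier.integral_fourierIntegral_smul_eq_flip (L := innerₗ V)
      Real.continuous_fourierChar continuous_inner φ.integrable hf

theorem norm_fourier_le_integral_norm (f : V → ℂ) (ξ : V) : ‖𝓕 f ξ‖ ≤ ∫ x, ‖f x‖ :=
  VectorFourier.norm_fourierIntegral_le_integral_norm _ _ _ _ _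

theorem continuous_fourier_of_integrable {f : V → ℂ} (hf : Integrable f) : Continuous (𝓕 f) :=
  VectorFourier.fourierIntegral_continuous Real.continuous_fourierChar continuous_inner hf

/-- The integral transform and the Plancherel extension have the same pairings with Schwartz
functions. This carries the `L²` isometry over to the integral. -/
theorem fourier_ae_eq_fourier_toLp {f : V → ℂ} (hf : Integrable f) (hf2 : MemLp f 2) :
    𝓕 f =ᵐ[volume] (𝓕 (hf2.toLp f) : Lp ℂ 2 (volume : Measure V)) := by
  refine ae_eq_of_forall_integral_schwartz_smul_eq
    (continuous_fourier_of_integrable hf).locallyIntegrable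
    ((Lp.memLp _).locallyIntegrable one_le_two) fun φ => ?_
  have h := DFunLike.congr_fun (Lp.fourier_toTemperedDistribution_eq (hf2.toLp f)) φ
  rw [TemperedDistribution.fourier_apply, Lp.toTemperedDistribution_apply,
    Lp.toTemperedDistribution_apply] at h
  rw [← h, ← integral_fourier_schwartz_smul_eq φ hf]
  refine integral_congr_ae ?_
  filter_upwards [hf2.coeFn_toLp] with x hx
  rw [hx]

theorem memLp_fourier_two {f : V → ℂ} (hf : Integrable f) (hf2 : MemLp f 2) : MemLp (𝓕 f) 2 :=
  (memLp_congr_ae (fourier_ae_eq_fourier_toLp hf hf2)).2 (Lp.memLp _)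

theorem eLpNorm_fourier_two {f : V → ℂ} (hf : Integrable f) (hf2 : MemLp f 2) :
    eLpNorm (𝓕 f) 2 = eLpNorm f 2 := by
  rw [eLpNorm_congr_ae (fourier_ae_eq_fourier_toLp hf hf2), ← Lp.enorm_def]
  rw [← ofReal_norm, Lp.norm_fourier_eq, ofReal_norm, Lp.enorm_def,
    eLpNorm_congr_ae hf2.coeFn_toLp]

theorem fourier_sum_smul {ι : Type*} (s : Finset ι) (c : ι → ℂ) (f : ι → V → ℂ)
    (hf : ∀ i ∈ s, Integrable (f i)) (ξ : V) :
    𝓕 (fun v => ∑ i ∈ s, c i * f i v) ξ = ∑ i ∈ s, c i * 𝓕 (f i) ξ := by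
  simp only [Real.fourier_eq]
  simp_rw [Finset.smul_sum]
  rw [integral_finsetSum]
  · refine Finset.sum_congr rfl fun i _ => ?_
    rw [← integral_const_mul]
    congr 1; ext v
    simp only [Circle.smul_def, smul_eq_mul]; ring
  · intro i hi
    rw [Real.fourierIntegral_convergent_iff]
    exact (hf i hi).const_mul _

end FourierLp

/-! ### Simple functions with fixed level sets and varying coefficients -/

namespace MeasureTheory.SimpleFunc

variable {α : Type*} [MeasurableSpace α]

/-- The linear combination with coefficients `x c` of the indicators of the level sets `f = c` of
a simple function, for the nonzero values `c`. -/
noncomputable def levelComb (f : SimpleFunc α ℂ) (x : ℂ → ℂ) (v : α) : ℂ :=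
  ∑ c ∈ f.range.filter (· ≠ 0), x c * (f ⁻¹' {c}).indicator 1 v

theorem sum_mul_indicator_level {R : Type*} [Semiring R] (f : SimpleFunc α ℂ) (h : ℂ → R) (v : α) :
    ∑ c ∈ f.range.filter (· ≠ 0), h c * (f ⁻¹' {c}).indicator 1 v =
      if f v = 0 then 0 else h (f v) := by
  classical
  have : ∀ c, h c * (f ⁻¹' {c}).indicator 1 v = if f v = c then h c else 0 := by
    intro c
    by_cases hc : f v = c <;> simp [Set.indicator, hc]
  simp only [this, Finset.sum_ite_eq]
  by_cases h0 : f v = 0 <;> simp [h0]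

theorem levelComb_eq (f : SimpleFunc α ℂ) (x : ℂ → ℂ) (v : α) :
    f.levelComb x v = if f v = 0 then 0 else x (f v) := sum_mul_indicator_level f x v

theorem levelComb_id (f : SimpleFunc α ℂ) : f.levelComb id = f := by
  ext v
  rw [levelComb_eq]
  by_cases h0 : f v = 0 <;> simp [h0]

variable {μ : Measure α}

theorem integrable_indicator_level {R : Type*} [NormedRing R] (f : SimpleFunc α ℂ) (hf : Integrable f μ)
    {c : ℂ} (hc : c ≠ 0) : Integrable ((f ⁻¹' {c}).indicator (1 : α → R)) μ :=
  (integrable_indicator_iff (f.measurableSet_fiber c)).2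
    (integrableOn_const (SimpleFunc.measure_preimage_lt_top_of_integrable f hf hc).ne)

theorem norm_levelComb_rpow (f : SimpleFunc α ℂ) (x : ℂ → ℂ) {q : ℝ} (hq : 0 < q) (v : α) :
    ‖f.levelComb x v‖ ^ q =
      ∑ c ∈ f.range.filter (· ≠ 0), ‖x c‖ ^ q * (f ⁻¹' {c}).indicator (1 : α → ℝ) v := by
  rw [sum_mul_indicator_level f (fun c => ‖x c‖ ^ q), levelComb_eq]
  by_cases h0 : f v = 0 <;> simp [h0, hq.ne']

/-- Makes `L_q` norms on fixed level sets into weighted `ℓ^q` norms of the coefficients, the form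
required by the finite interpolation. -/
theorem integral_norm_levelComb_rpow (f : SimpleFunc α ℂ) (hf : Integrable f μ) (x : ℂ → ℂ) {q : ℝ}
    (hq : 0 < q) : ∫ v, ‖f.levelComb x v‖ ^ q ∂μ =
      ∑ c ∈ f.range.filter (· ≠ 0), μ.real (f ⁻¹' {c}) * ‖x c‖ ^ q := by
  simp only [norm_levelComb_rpow f x hq]
  rw [integral_finsetSum]
  · refine Finset.sum_congr rfl fun c _ => ?_
    rw [integral_const_mul, integral_indicator_one (f.measurableSet_fiber c), mul_comm]
  · intro c hc
    exact (f.integrable_indicator_level hf (Finset.mem_filter.1 hc).2).const_mul _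

theorem memLp_levelComb (f : SimpleFunc α ℂ) (hf : Integrable f μ) (x : ℂ → ℂ) (p : ℝ≥0∞) :
    MemLp (f.levelComb x) p μ := by
  have : f.levelComb x = fun v => ∑ c ∈ f.range.filter (· ≠ 0),
      (f ⁻¹' {c}).indicator (fun _ => x c) v := by
    ext v
    refine Finset.sum_congr rfl fun c _ => ?_
    by_cases hc : f v = c <;> simp [Set.indicator, hc]
  rw [this]
  refine memLp_finsetSum _ fun c hc => ?_
  exact memLp_indicator_const p (f.measurableSet_fiber c) _ (Or.inr
    (SimpleFunc.measure_preimage_lt_top_of_integrable f hf (Finset.mem_filter.1 hc).2).ne)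

end MeasureTheory.SimpleFunc

/-! ### Hausdorff–Young as a bilinear estimate on simple functions -/

section HausdorffYoung

open FourierTransform

variable {V : Type*} [NormedAddCommGroup V] [InnerProductSpace ℝ V] [FiniteDimensional ℝ V]
  [MeasurableSpace V] [BorelSpace V]

theorem norm_integral_fourier_mul_le_one {f g : V → ℂ} (hg : Integrable g) :
    ‖∫ ξ, 𝓕 f ξ * g ξ‖ ≤ (∫ v, ‖f v‖) * ∫ v, ‖g v‖ := by
  rw [← integral_const_mul]
  refine norm_integral_le_of_norm_le (hg.norm.const_mul _) (Filter.Eventually.of_forall fun ξ => ?_)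
  rw [norm_mul]
  gcongr
  exact norm_fourier_le_integral_norm f ξ

theorem norm_integral_fourier_mul_le_two {f g : V → ℂ} (hf : Integrable f) (hf2 : MemLp f 2)
    (hg2 : MemLp g 2) : ‖∫ ξ, 𝓕 f ξ * g ξ‖ ≤
      (∫ v, ‖f v‖ ^ (2 : ℝ)) ^ (2⁻¹ : ℝ) * (∫ v, ‖g v‖ ^ (2 : ℝ)) ^ (2⁻¹ : ℝ) := by
  have h2 : ENNReal.ofReal 2 = 2 := by simp
  have h := integral_mul_norm_le_Lp_mul_Lq (μ := (volume : Measure V)) (f := 𝓕 f) (g := g)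
    Real.HolderConjugate.two_two (by rw [h2]; exact memLp_fourier_two hf hf2) (by rwa [h2])
  have e : (∫ v, ‖𝓕 f v‖ ^ (2 : ℝ)) ^ (2⁻¹ : ℝ) = (∫ v, ‖f v‖ ^ (2 : ℝ)) ^ (2⁻¹ : ℝ) := by
    have := eLpNorm_fourier_two hf hf2
    rw [MemLp.eLpNorm_eq_integral_rpow_norm (by simp) (by simp) (memLp_fourier_two hf hf2),
      MemLp.eLpNorm_eq_integral_rpow_norm (by simp) (by simp) hf2] at this
    rw [ENNReal.ofReal_eq_ofReal_iff (by positivity) (by positivity)] at this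
    simpa using this
  simp only [one_div] at h
  rw [e] at h
  refine (norm_integral_le_integral_norm _).trans ?_
  simpa only [norm_mul] using h

theorem integral_fourier_mul_levelComb (f g : SimpleFunc V ℂ) (hf : Integrable f) (hg : Integrable g)
    (x y : ℂ → ℂ) : ∫ ξ, 𝓕 (f.levelComb x) ξ * g.levelComb y ξ =
      ∑ c ∈ f.range.filter (· ≠ 0), ∑ d ∈ g.range.filter (· ≠ 0), x c * y d *
        ∫ ξ, 𝓕 ((f ⁻¹' {c}).indicator (1 : V → ℂ)) ξ * (g ⁻¹' {d}).indicator (1 : V → ℂ) ξ := by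
  have hi : ∀ c ∈ f.range.filter (· ≠ 0), ∀ d ∈ g.range.filter (· ≠ 0), Integrable fun ξ =>
      x c * y d * (𝓕 ((f ⁻¹' {c}).indicator (1 : V → ℂ)) ξ *
        (g ⁻¹' {d}).indicator (1 : V → ℂ) ξ) := by
    intro c hc d hd
    have h1 := f.integrable_indicator_level (R := ℂ) hf (Finset.mem_filter.1 hc).2
    have h2 := g.integrable_indicator_level (R := ℂ) hg (Finset.mem_filter.1 hd).2
    refine Integrable.const_mul ?_ _
    exact h2.bdd_mul (continuous_fourier_of_integrable h1).aestronglyMeasurable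
      (Filter.Eventually.of_forall (norm_fourier_le_integral_norm _))
  simp_rw [← integral_const_mul]
  rw [Finset.sum_congr rfl fun c hc => (integral_finsetSum _ (hi c hc)).symm,
    ← integral_finsetSum _ fun c hc => integrable_finsetSum _ (hi c hc)]
  refine integral_congr_ae (Filter.Eventually.of_forall fun ξ => ?_)
  have hF : 𝓕 (f.levelComb x) ξ = ∑ c ∈ f.range.filter (· ≠ 0),
      x c * 𝓕 ((f ⁻¹' {c}).indicator (1 : V → ℂ)) ξ :=
    fourier_sum_smul _ x _
      (fun c hc => f.integrable_indicator_level hf (Finset.mem_filter.1 hc).2) ξ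
  simp only [hF, SimpleFunc.levelComb, Finset.sum_mul_sum]
  refine Finset.sum_congr rfl fun c _ => Finset.sum_congr rfl fun d _ => ?_
  ring

/-- On the level sets of `f` and `g` the pairing is a finite bilinear form in the coefficients. Its
endpoint bounds are the sup bound for `𝓕` and Plancherel with Cauchy–Schwarz; interpolation applies
to the coefficients of `f` and `g` themselves. -/
theorem norm_integral_fourier_mul_le (f g : SimpleFunc V ℂ) (hf : Integrable f) (hg : Integrable g)
    {t : ℝ} (ht1 : 1 ≤ t) (ht2 : t ≤ 2) : ‖∫ ξ, 𝓕 (f : V → ℂ) ξ * g ξ‖ ≤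
      (∫ v, ‖f v‖ ^ t) ^ t⁻¹ * (∫ v, ‖g v‖ ^ t) ^ t⁻¹ := by
  have ht0 : 0 < t := by linarith
  have key := norm_bilin_le_of_endpoint_bounds (f.range.filter (· ≠ 0)) (g.range.filter (· ≠ 0))
    (fun c => volume.real (f ⁻¹' {c})) (fun c => volume.real (g ⁻¹' {c}))
    (fun c d => ∫ ξ, 𝓕 ((f ⁻¹' {c}).indicator (1 : V → ℂ)) ξ * (g ⁻¹' {d}).indicator (1 : V → ℂ) ξ)
    (fun x y => by
      rw [← integral_fourier_mul_levelComb f g hf hg]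
      have h := norm_integral_fourier_mul_le_one (f := f.levelComb x)
        (memLp_one_iff_integrable.1 (g.memLp_levelComb hg y 1))
      have h1 := f.integral_norm_levelComb_rpow hf x one_pos
      have h2 := g.integral_norm_levelComb_rpow hg y one_pos
      simp only [Real.rpow_one] at h1 h2
      rwa [h1, h2] at h)
    (fun x y => by
      rw [← integral_fourier_mul_levelComb f g hf hg,
        ← f.integral_norm_levelComb_rpow hf x two_pos,
        ← g.integral_norm_levelComb_rpow hg y two_pos]
      exact norm_integral_fourier_mul_le_two
        (memLp_one_iff_integrable.1 (f.memLp_levelComb hf x 1)) (f.memLp_levelComb hf x 2)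
        (g.memLp_levelComb hg y 2))
    (fun _ => measureReal_nonneg) (fun _ => measureReal_nonneg) ht1 ht2 id id
  rw [← integral_fourier_mul_levelComb f g hf hg, ← f.integral_norm_levelComb_rpow hf id ht0,
    ← g.integral_norm_levelComb_rpow hg id ht0, f.levelComb_id, g.levelComb_id] at key
  exact key

end HausdorffYoung

/-! ### Norms in `L_q` by duality with simple functions -/

section LpDuality

variable {α : Type*} [MeasurableSpace α] {μ : Measure α} {p q : ℝ≥0∞}

theorem norm_integral_mul_le_of_forall_simpleFunc [Fact (1 ≤ p)] [hpq : q.HolderConjugate p]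
    (hp : p ≠ ∞) {h : α → ℂ} (hh : MemLp h q μ) {M : ℝ}
    (H : ∀ g : SimpleFunc α ℂ, MemLp g p μ → ‖∫ x, h x * g x ∂μ‖ ≤ M * (eLpNorm g p μ).toReal)
    {g : α → ℂ} (hg : MemLp g p μ) : ‖∫ x, h x * g x ∂μ‖ ≤ M * (eLpNorm g p μ).toReal := by
  have : Fact (1 ≤ q) := ⟨hpq.one_le⟩
  set T := (ContinuousLinearMap.mul ℂ ℂ).lpPairing μ q p (hh.toLp h)
  have hT : ∀ (g : α → ℂ) (hg : MemLp g p μ), T (hg.toLp g) = ∫ x, h x * g x ∂μ := by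
    intro g hg
    rw [ContinuousLinearMap.lpPairing_eq_integral]
    refine integral_congr_ae ?_
    filter_upwards [hh.coeFn_toLp, hg.coeFn_toLp] with x h1 h2
    rw [h1, h2]; rfl
  have key : ∀ G : Lp ℂ p μ, ‖T G‖ ≤ M * ‖G‖ := by
    intro G
    refine (Lp.simpleFunc.denseRange (E := ℂ) (μ := μ) hp).induction_on (p := fun G => ‖T G‖ ≤ M * ‖G‖)
      G (isClosed_le (by fun_prop) (by fun_prop)) fun g => ?_
    have e : (g : Lp ℂ p μ) = (Lp.simpleFunc.memLp g).toLp _ :=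
      congrArg Subtype.val (Lp.simpleFunc.toLp_toSimpleFunc g).symm
    rw [e, hT, Lp.norm_toLp]
    exact H _ (Lp.simpleFunc.memLp g)
  simpa [hT, Lp.norm_toLp] using key (hg.toLp g)

/-- Density extends the bound to all of `L_p`, in particular to the extremal function of Hölder's
inequality. Knowing beforehand that `h` is in `L_q` makes it legitimate to divide by a power of the
integral. -/
theorem eLpNorm_le_of_forall_simpleFunc [Fact (1 ≤ p)] [hpq : q.HolderConjugate p]
    (hp : p ≠ ∞) (hq : q ≠ ∞) {h : α → ℂ} (hh : MemLp h q μ) {M : ℝ} (hM : 0 ≤ M)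
    (H : ∀ g : SimpleFunc α ℂ, MemLp g p μ → ‖∫ x, h x * g x ∂μ‖ ≤ M * (eLpNorm g p μ).toReal) :
    eLpNorm h q μ ≤ ENNReal.ofReal M := by
  have hr := ENNReal.HolderConjugate.toReal_of_ne_top hq hp
  set p' := p.toReal
  set q' := q.toReal
  have hp0 : p ≠ 0 := (zero_lt_one.trans_le (Fact.out : 1 ≤ p)).ne'
  have hq0 : q ≠ 0 := (zero_lt_one.trans_le hpq.one_le).ne'
  have hp' : 0 < p' := hr.symm.pos
  have hq' : 0 < q' := hr.pos
  have hq1 : 1 < q' := hr.lt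
  have hmul : (q' - 1) * p' = q' := hr.sub_one_mul_conj
  -- Chosen so that `h g = |h|^q` and `|g|^p = |h|^q`.
  set g : α → ℂ := fun x => (starRingEnd ℂ) (h x) * (‖h x‖ ^ (q' - 2) : ℝ) with hg
  have hgn : ∀ x, ‖g x‖ ^ p' = ‖h x‖ ^ q' := by
    intro x
    rcases eq_or_ne (h x) 0 with h0 | h0
    · simp [hg, h0, hp'.ne', hq'.ne']
    · have : 0 < ‖h x‖ := norm_pos_iff.2 h0
      have e : ‖g x‖ = ‖h x‖ ^ (q' - 1) := by
        simp only [hg, norm_mul, RCLike.norm_conj, Complex.norm_real, Real.norm_eq_abs]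
        rw [abs_of_nonneg (by positivity)]
        nth_rw 1 [← Real.rpow_one ‖h x‖]
        rw [← Real.rpow_add this]
        congr 1; ring
      rw [e, ← Real.rpow_mul this.le, hmul]
  have hhg : ∀ x, h x * g x = ((‖h x‖ ^ q' : ℝ) : ℂ) := by
    intro x
    rcases eq_or_ne (h x) 0 with h0 | h0
    · simp [hg, h0, hq'.ne']
    · have : 0 < ‖h x‖ := norm_pos_iff.2 h0
      simp only [hg]
      rw [← mul_assoc, Complex.mul_conj, ← Complex.ofReal_mul, Complex.normSq_eq_norm_sq,
        ← Real.rpow_natCast, ← Real.rpow_add this]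
      norm_num
  have hgm : AEStronglyMeasurable g μ := by
    have := hh.1.aemeasurable
    refine AEMeasurable.aestronglyMeasurable ?_
    fun_prop
  have hgp : MemLp g p μ := by
    rw [← integrable_norm_rpow_iff hgm hp0 hp]
    exact (hh.integrable_norm_rpow hq0 hq).congr
      (Filter.Eventually.of_forall fun x => (hgn x).symm)
  have h1 := norm_integral_mul_le_of_forall_simpleFunc hp hh H hgp
  simp only [hhg] at h1
  rw [integral_complex_ofReal, hgp.eLpNorm_eq_integral_rpow_norm hp0 hp] at h1
  rw [hh.eLpNorm_eq_integral_rpow_norm hq0 hq]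
  change ‖((∫ x, ‖h x‖ ^ q' ∂μ : ℝ) : ℂ)‖ ≤ M * (ENNReal.ofReal ((∫ x, ‖g x‖ ^ p' ∂μ) ^ p'⁻¹)).toReal at h1
  change ENNReal.ofReal ((∫ x, ‖h x‖ ^ q' ∂μ) ^ q'⁻¹) ≤ _
  simp only [hgn] at h1
  have hI : 0 ≤ ∫ x, ‖h x‖ ^ q' ∂μ := by positivity
  set I := ∫ x, ‖h x‖ ^ q' ∂μ
  rw [Complex.norm_real, Real.norm_of_nonneg hI, ENNReal.toReal_ofReal (by positivity)] at h1
  refine ENNReal.ofReal_le_ofReal ?_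
  rcases hI.eq_or_lt with h0 | h0
  · rw [← h0, Real.zero_rpow (by positivity)]; exact hM
  · have e : I = I ^ q'⁻¹ * I ^ p'⁻¹ := by
      rw [← Real.rpow_add h0, hr.inv_add_inv_eq_one, Real.rpow_one]
    nth_rw 1 [e] at h1
    exact le_of_mul_le_mul_right h1 (by positivity)

end LpDuality

/-! ### The Hausdorff–Young inequality -/

section HausdorffYoung

open FourierTransform

variable {V : Type*} [NormedAddCommGroup V] [InnerProductSpace ℝ V] [FiniteDimensional ℝ V]
  [MeasurableSpace V] [BorelSpace V]

/-- Supplies the a priori membership demanded by duality: the transform of an integrable simple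
function is bounded and in `L²`. -/
theorem MemLp.of_two_of_bound {f : V → ℂ} (hf : MemLp f 2) {C : ℝ} (hC : ∀ x, ‖f x‖ ≤ C)
    {q : ℝ≥0∞} (hq : 2 ≤ q) : MemLp f q := by
  rcases eq_or_ne q ∞ with rfl | hqt
  · exact memLp_top_of_bound hf.1 C (Filter.Eventually.of_forall hC)
  have hq0 : q ≠ 0 := (two_pos.trans_le hq).ne'
  have hq2 : 2 ≤ q.toReal := by simpa using ENNReal.toReal_mono hqt hq
  have hC0 : 0 ≤ C := (norm_nonneg _).trans (hC 0)
  rw [← integrable_norm_rpow_iff hf.1 hq0 hqt]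
  refine ((hf.integrable_norm_rpow (by simp) (by simp)).const_mul (C ^ (q.toReal - 2))).mono'
    ((hf.1.norm.aemeasurable.pow_const _).aestronglyMeasurable)
    (Filter.Eventually.of_forall fun x => ?_)
  rw [Real.norm_of_nonneg (by positivity)]
  rcases eq_or_ne (f x) 0 with h0 | h0
  · rw [h0, norm_zero, Real.zero_rpow (by linarith)]
    positivity
  · have : 0 < ‖f x‖ := norm_pos_iff.2 h0
    have e : ‖f x‖ ^ q.toReal = ‖f x‖ ^ (q.toReal - 2) * ‖f x‖ ^ (2 : ℝ) := by
      rw [← Real.rpow_add this]; congr 1; ring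
    rw [e, ENNReal.toReal_ofNat]
    gcongr
    exact hC x

theorem eLpNorm_fourier_simpleFunc_le {p q : ℝ≥0∞} [Fact (1 ≤ p)] [hpq : q.HolderConjugate p]
    (hp2 : p ≤ 2) (hq : q ≠ ∞) (f : SimpleFunc V ℂ) (hf : MemLp f p volume) :
    MemLp (𝓕 (f : V → ℂ)) q ∧ eLpNorm (𝓕 (f : V → ℂ)) q volume ≤ eLpNorm f p volume := by
  have hp : p ≠ ∞ := (hp2.trans_lt (by simp)).ne
  have hp0 : p ≠ 0 := (zero_lt_one.trans_le (Fact.out : 1 ≤ p)).ne'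
  have hq2 : 2 ≤ q := by
    have h1 : q⁻¹ + p⁻¹ = 1 := ENNReal.HolderConjugate.inv_add_inv_eq_one q p
    have h2 : q⁻¹ + 2⁻¹ ≤ 2⁻¹ + 2⁻¹ := by
      rw [ENNReal.inv_two_add_inv_two, ← h1]
      gcongr
    exact ENNReal.inv_le_inv.1 ((ENNReal.add_le_add_iff_right (by simp)).1 h2)
  have hi1 : ∀ f : SimpleFunc V ℂ, MemLp f p volume → Integrable f := fun f hf =>
    (SimpleFunc.memLp_iff_integrable hp0 hp).1 hf
  have hq' : MemLp (𝓕 (f : V → ℂ)) q :=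
    MemLp.of_two_of_bound (memLp_fourier_two (hi1 f hf) (f.levelComb_id ▸ f.memLp_levelComb (hi1 f hf) id 2))
      (norm_fourier_le_integral_norm f) hq2
  have hint : ∀ f : SimpleFunc V ℂ, MemLp f p volume →
      (∫ v, ‖f v‖ ^ p.toReal) ^ p.toReal⁻¹ = (eLpNorm f p volume).toReal := by
    intro f hf
    rw [hf.eLpNorm_eq_integral_rpow_norm hp0 hp, ENNReal.toReal_ofReal (by positivity)]
  refine ⟨hq', ?_⟩
  rw [← ENNReal.ofReal_toReal hf.2.ne]
  refine eLpNorm_le_of_forall_simpleFunc hp hq hq' ENNReal.toReal_nonneg fun g hg => ?_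
  rw [← hint f hf, ← hint g hg]
  refine norm_integral_fourier_mul_le f g (hi1 f hf) (hi1 g hg) ?_ ?_
  · simpa using ENNReal.toReal_mono hp (Fact.out : 1 ≤ p)
  · simpa using ENNReal.toReal_mono (by simp) hp2

theorem fourier_toTemperedDistribution_toLp {p q : ℝ≥0∞} [Fact (1 ≤ p)] [Fact (1 ≤ q)]
    {f : V → ℂ} (hf : Integrable f) (hfp : MemLp f p) (hfq : MemLp (𝓕 f) q) :
    𝓕 (Lp.toTemperedDistribution (hfp.toLp f)) = Lp.toTemperedDistribution (hfq.toLp (𝓕 f)) := by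
  ext φ
  rw [TemperedDistribution.fourier_apply, Lp.toTemperedDistribution_apply,
    Lp.toTemperedDistribution_apply]
  have h1 : ∫ x, (𝓕 φ) x • hfp.toLp f x = ∫ x, (𝓕 φ) x • f x := integral_congr_ae <| by
    filter_upwards [hfp.coeFn_toLp] with x hx
    rw [hx]
  have h2 : ∫ x, φ x • hfq.toLp (𝓕 f) x = ∫ x, φ x • 𝓕 f x := integral_congr_ae <| by
    filter_upwards [hfq.coeFn_toLp] with x hx
    rw [hx]
  rw [h1, h2, integral_fourier_schwartz_smul_eq φ hf]

/-- If a continuous linear map of tempered distributions sends a dense subgroup of `L_p` into `L_q`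
without increasing the norm, then it does so on all of `L_p`. -/
theorem exists_norm_le_of_dense {p q : ℝ≥0∞} [Fact (1 ≤ p)] [Fact (1 ≤ q)]
    (T : 𝓢'(V, ℂ) →L[ℂ] 𝓢'(V, ℂ)) (S : AddSubgroup (Lp ℂ p (volume : Measure V)))
    (hS : Dense (S : Set (Lp ℂ p (volume : Measure V))))
    (h : ∀ f ∈ S, ∃ g : Lp ℂ q (volume : Measure V), ‖g‖ ≤ ‖f‖ ∧
      T (Lp.toTemperedDistribution f) = Lp.toTemperedDistribution g)
    (f : Lp ℂ p (volume : Measure V)) :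
    ∃ g : Lp ℂ q (volume : Measure V), ‖g‖ ≤ ‖f‖ ∧
      T (Lp.toTemperedDistribution f) = Lp.toTemperedDistribution g := by
  obtain ⟨u, huS, hu⟩ := mem_closure_iff_seq_limit.1 (hS f)
  choose g hg using fun k => h (u k) (huS k)
  set ιp := Lp.toTemperedDistributionCLM ℂ (volume : Measure V) p
  set ιq := Lp.toTemperedDistributionCLM ℂ (volume : Measure V) q
  -- The bound is applied to `u k - u l`, which is again in `S`; injectivity of `L_q` into the
  -- distributions identifies its image as `g k - g l`. Hence `g` is Cauchy.
  have hgd : ∀ k l, ‖g k - g l‖ ≤ ‖u k - u l‖ := by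
    intro k l
    obtain ⟨d, hd, hd'⟩ := h (u k - u l) (S.sub_mem (huS k) (huS l))
    have : ιq d = ιq (g k - g l) := by
      change T (ιp (u k - u l)) = ιq d at hd'
      rw [map_sub, ← hd', map_sub, map_sub]
      congr 1
      · exact (hg k).2
      · exact (hg l).2
    rwa [← LinearMap.ker_eq_bot.1 (Lp.ker_toTemperedDistributionCLM_eq_bot (F := ℂ)
      (μ := (volume : Measure V)) (p := q)) this]
  have hc : CauchySeq g := by
    have := hu.cauchySeq
    rw [Metric.cauchySeq_iff] at this ⊢
    intro ε hε
    obtain ⟨N, hN⟩ := this ε hε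
    refine ⟨N, fun m hm n hn => ?_⟩
    have := hN m hm n hn
    rw [dist_eq_norm] at this ⊢
    exact (hgd m n).trans_lt this
  obtain ⟨g₀, hg₀⟩ := cauchySeq_tendsto_of_complete hc
  refine ⟨g₀, le_of_tendsto_of_tendsto' hg₀.norm hu.norm fun k => (hg k).1, ?_⟩
  have h1 : Filter.Tendsto (fun k => T (ιp (u k))) Filter.atTop (nhds (T (ιp f))) :=
    (T.continuous.comp ιp.continuous).continuousAt.tendsto.comp hu
  have h2 : Filter.Tendsto (fun k => ιq (g k)) Filter.atTop (nhds (ιq g₀)) :=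
    ιq.continuous.continuousAt.tendsto.comp hg₀
  have h3 : (fun k => T (ιp (u k))) = fun k => ιq (g k) := funext fun k => (hg k).2
  rw [h3] at h1
  exact tendsto_nhds_unique h1 h2

/-- The **Hausdorff–Young inequality**. -/
theorem exists_fourier_eq_toTemperedDistribution {p q : ℝ≥0∞} [Fact (1 ≤ p)] [Fact (1 ≤ q)]
    [hpq : q.HolderConjugate p] (hp2 : p ≤ 2) (f : Lp ℂ p (volume : Measure V)) :
    ∃ g : Lp ℂ q (volume : Measure V), ‖g‖ ≤ ‖f‖ ∧
      𝓕 (Lp.toTemperedDistribution f) = Lp.toTemperedDistribution g := by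
  -- The duality argument excludes `q = ∞`; there `p = 1` and the sup bound is direct.
  rcases eq_or_ne q ∞ with rfl | hq
  · have hp1 : p = 1 := (ENNReal.HolderConjugate.eq_top_iff_eq_one ∞ p).1 rfl
    subst hp1
    have hf := memLp_one_iff_integrable.1 (Lp.memLp f)
    have hm : MemLp (𝓕 (f : V → ℂ)) ∞ := memLp_top_of_bound
      (continuous_fourier_of_integrable hf).aestronglyMeasurable _
      (Filter.Eventually.of_forall (norm_fourier_le_integral_norm f))
    refine ⟨hm.toLp _, ?_, ?_⟩
    · rw [Lp.norm_toLp, L1.norm_eq_integral_norm, eLpNorm_exponent_top]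
      exact ENNReal.toReal_le_of_le_ofReal (by positivity) (eLpNormEssSup_le_of_ae_bound
        (Filter.Eventually.of_forall (norm_fourier_le_integral_norm f)))
    · rw [← fourier_toTemperedDistribution_toLp hf (Lp.memLp f) hm, Lp.toLp_coeFn]
  have hp : p ≠ ∞ := (hp2.trans_lt (by simp)).ne
  refine exists_norm_le_of_dense (fourierCLM ℂ 𝓢'(V, ℂ)) (Lp.simpleFunc ℂ p volume)
    (Lp.simpleFunc.dense hp) (fun f hf => ?_) f
  have hf' := Lp.simpleFunc.memLp (⟨f, hf⟩ : Lp.simpleFunc ℂ p (volume : Measure V))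
  have e : f = hf'.toLp _ := congrArg Subtype.val (Lp.simpleFunc.toLp_toSimpleFunc
    (⟨f, hf⟩ : Lp.simpleFunc ℂ p (volume : Measure V))).symm
  obtain ⟨h1, h2⟩ := eLpNorm_fourier_simpleFunc_le hp2 hq _ hf'
  have hp0 : p ≠ 0 := (zero_lt_one.trans_le (Fact.out : 1 ≤ p)).ne'
  refine ⟨h1.toLp _, ?_, ?_⟩
  · rw [Lp.norm_toLp, congrArg norm e, Lp.norm_toLp]
    exact ENNReal.toReal_mono hf'.2.ne h2
  · rw [← fourier_toTemperedDistribution_toLp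
      ((SimpleFunc.memLp_iff_integrable hp0 hp).1 hf') hf' h1, ← e]
    rfl

/-- The **Hausdorff–Young inequality** for the inverse Fourier transform. -/
theorem exists_fourierInv_eq_toTemperedDistribution {p q : ℝ≥0∞} [Fact (1 ≤ p)] [Fact (1 ≤ q)]
    [hpq : q.HolderConjugate p] (hp2 : p ≤ 2) (f : Lp ℂ p (volume : Measure V)) :
    ∃ g : Lp ℂ q (volume : Measure V), ‖g‖ ≤ ‖f‖ ∧
      𝓕⁻ (Lp.toTemperedDistribution f) = Lp.toTemperedDistribution g := by
  have hneg : MeasurePreserving (fun x : V => -x) volume volume :=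
    Measure.measurePreserving_neg volume
  -- The inverse transform of `f` is the transform of its reflection.
  set f' := Lp.compMeasurePreserving (fun x : V => -x) hneg f
  obtain ⟨g, hg, hg'⟩ := exists_fourier_eq_toTemperedDistribution (q := q) hp2 f'
  refine ⟨g, hg.trans_eq (Lp.norm_compMeasurePreserving f hneg), ?_⟩
  rw [← hg']
  ext φ
  rw [TemperedDistribution.fourier_apply, TemperedDistribution.fourierInv_apply,
    Lp.toTemperedDistribution_apply, Lp.toTemperedDistribution_apply]
  have h1 : ∫ x, (𝓕 φ) x • f' x = ∫ x, (𝓕 φ) x • f (-x) := integral_congr_ae <| by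
    filter_upwards [Lp.coeFn_compMeasurePreserving f hneg] with x hx
    rw [hx]; rfl
  rw [h1, ← integral_neg_eq_self]
  refine integral_congr_ae (Filter.Eventually.of_forall fun x => ?_)
  beta_reduce
  rw [SchwartzMap.fourierInv_coe, SchwartzMap.fourier_coe, Real.fourierInv_eq_fourier_neg, neg_neg]

end HausdorffYoung

/-! ### The symbol of the free resolvent: norms and regularity -/

section ResolventSymbol

open Real Set

theorem lintegral_rpow_mul_exp_neg_mul_Ioi {a r : ℝ} (ha : 0 < a) (hr : 0 < r) :
    ∫⁻ t in Ioi (0 : ℝ), ENNReal.ofReal (t ^ (a - 1) * exp (-(r * t))) =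
      ENNReal.ofReal ((1 / r) ^ a * Gamma a) := by
  have h := integral_rpow_mul_exp_neg_mul_Ioi ha hr
  have hG := Gamma_pos_of_pos ha
  rw [← h, ofReal_integral_eq_lintegral_ofReal]
  -- A nonintegrable function has Bochner integral zero, so a positive value proves integrability.
  · exact Integrable.of_integral_ne_zero (by rw [h]; positivity)
  · filter_upwards [ae_restrict_mem measurableSet_Ioi] with t ht
    have : 0 < t := ht
    positivity

variable {V : Type*} [NormedAddCommGroup V] [InnerProductSpace ℝ V] [FiniteDimensional ℝ V]
  [MeasurableSpace V] [BorelSpace V]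

theorem lintegral_exp_neg_mul_sq_norm {b : ℝ} (hb : 0 < b) :
    ∫⁻ v : V, ENNReal.ofReal (exp (-b * ‖v‖ ^ 2)) =
      ENNReal.ofReal ((π / b) ^ (Module.finrank ℝ V / 2 : ℝ)) := by
  have h := GaussianFourier.integral_rexp_neg_mul_sq_norm (V := V) hb
  rw [← h, ofReal_integral_eq_lintegral_ofReal]
  · exact Integrable.of_integral_ne_zero (by rw [h]; positivity)
  · exact Filter.Eventually.of_forall fun v => (exp_pos _).le

/-- Write `x ^ (-α)` as `Γ(α)⁻¹ ∫ t ^ (α - 1) e ^ (-x t) dt` and swap the integrals by Tonelli. With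
`d` half the dimension, the Gaussian integral in `v` contributes `(π / (c t)) ^ d`, leaving a Gamma
integral at `α - d`, convergent because `d < α`. -/
theorem lintegral_mul_sq_norm_add_rpow_neg {c κ α : ℝ} (hc : 0 < c) (hκ : 0 < κ)
    (hα : (Module.finrank ℝ V : ℝ) / 2 < α) :
    ∫⁻ v : V, ENNReal.ofReal ((c * ‖v‖ ^ 2 + κ) ^ (-α)) =
      ENNReal.ofReal ((π / c) ^ (Module.finrank ℝ V / 2 : ℝ) *
        (Gamma (α - Module.finrank ℝ V / 2) / Gamma α) *
        κ ^ ((Module.finrank ℝ V : ℝ) / 2 - α)) := by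
  set d : ℝ := (Module.finrank ℝ V : ℝ) / 2 with hd
  have hd0 : 0 ≤ d := by positivity
  have hα0 : 0 < α := hd0.trans_lt hα
  have hG : 0 < Gamma α := Gamma_pos_of_pos hα0
  have hG' : 0 < Gamma (α - d) := Gamma_pos_of_pos (sub_pos.2 hα)
  have h1 : ∀ v : V, ENNReal.ofReal ((c * ‖v‖ ^ 2 + κ) ^ (-α)) = ENNReal.ofReal (Gamma α)⁻¹ *
      ∫⁻ t in Ioi (0 : ℝ), ENNReal.ofReal (t ^ (α - 1) * exp (-((c * ‖v‖ ^ 2 + κ) * t))) := by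
    intro v
    have hv : 0 < c * ‖v‖ ^ 2 + κ := by positivity
    rw [lintegral_rpow_mul_exp_neg_mul_Ioi hα0 hv, ← ENNReal.ofReal_mul (by positivity)]
    congr 1
    rw [one_div, inv_rpow hv.le, rpow_neg hv.le]
    field_simp
  simp_rw [h1]
  rw [lintegral_const_mul _ (by fun_prop), lintegral_lintegral_swap (by fun_prop)]
  have h2 : ∀ t ∈ Ioi (0 : ℝ),
      ∫⁻ v : V, ENNReal.ofReal (t ^ (α - 1) * exp (-((c * ‖v‖ ^ 2 + κ) * t))) =
      ENNReal.ofReal ((π / c) ^ d) * ENNReal.ofReal (t ^ (α - d - 1) * exp (-(κ * t))) := by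
    intro t ht
    have ht : 0 < t := ht
    have e : ∀ v : V, ENNReal.ofReal (t ^ (α - 1) * exp (-((c * ‖v‖ ^ 2 + κ) * t))) =
        ENNReal.ofReal (t ^ (α - 1) * exp (-(κ * t))) *
          ENNReal.ofReal (exp (-(c * t) * ‖v‖ ^ 2)) := by
      intro v
      rw [← ENNReal.ofReal_mul (by positivity), mul_assoc, ← exp_add]
      congr 3; ring
    simp_rw [e]
    rw [lintegral_const_mul _ (by fun_prop), lintegral_exp_neg_mul_sq_norm (by positivity),
      ← ENNReal.ofReal_mul (by positivity), ← ENNReal.ofReal_mul (by positivity), ← hd]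
    congr 1
    rw [show π / (c * t) = π / c * t⁻¹ by field_simp, mul_rpow (by positivity) (by positivity),
      inv_rpow ht.le, ← rpow_neg ht.le, show α - d - 1 = (α - 1) + -d by ring, rpow_add ht]
    ring
  rw [setLIntegral_congr_fun measurableSet_Ioi h2, lintegral_const_mul _ (by fun_prop),
    lintegral_rpow_mul_exp_neg_mul_Ioi (sub_pos.2 hα) hκ, ← ENNReal.ofReal_mul (by positivity),
    ← ENNReal.ofReal_mul (by positivity)]
  congr 1
  rw [one_div, inv_rpow hκ.le, ← rpow_neg hκ.le, neg_sub]
  field_simp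

/-- The symbol `1 / (4 π² |ξ|² - μ)` of the resolvent of the negative Laplacian. -/
noncomputable def resolventSymbol (V : Type*) [NormedAddCommGroup V] (μ : ℂ) (ξ : V) : ℂ :=
  ((((2 * π) ^ 2 * ‖ξ‖ ^ 2 : ℝ) : ℂ) - μ)⁻¹

theorem le_norm_ofReal_sub (μ : ℂ) (x : ℝ) : x - μ.re ≤ ‖(x : ℂ) - μ‖ := by
  refine le_trans ?_ (Complex.re_le_norm _)
  simp

theorem norm_resolventSymbol_le {W : Type*} [NormedAddCommGroup W] {μ : ℂ} (hμ : μ.re < 0)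
    (ξ : W) : ‖resolventSymbol W μ ξ‖ ≤ ((2 * π) ^ 2 * ‖ξ‖ ^ 2 + |μ.re|)⁻¹ := by
  rw [resolventSymbol, norm_inv, abs_of_neg hμ]
  have h := le_norm_ofReal_sub μ ((2 * π) ^ 2 * ‖ξ‖ ^ 2)
  have h0 : 0 ≤ (2 * π) ^ 2 * ‖ξ‖ ^ 2 := by positivity
  exact inv_anti₀ (by linarith) (by linarith)

theorem continuous_resolventSymbol {W : Type*} [NormedAddCommGroup W] {μ : ℂ} (hμ : μ.re < 0) :
    Continuous (resolventSymbol W μ) := by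
  refine Continuous.inv₀ (by fun_prop) fun ξ h => ?_
  have h1 := le_norm_ofReal_sub μ ((2 * π) ^ 2 * ‖ξ‖ ^ 2)
  have : 0 ≤ (2 * π) ^ 2 * ‖ξ‖ ^ 2 := by positivity
  rw [h, norm_zero] at h1
  linarith

theorem eLpNorm_resolventSymbol_le {μ : ℂ} (hμ : μ.re < 0) {α : ℝ}
    (hα : (Module.finrank ℝ V : ℝ) / 2 < α) :
    eLpNorm (resolventSymbol V μ) (ENNReal.ofReal α) volume ≤
      ENNReal.ofReal (((4 * π) ^ (-((Module.finrank ℝ V : ℝ) / 2)) *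
        (Gamma (α - Module.finrank ℝ V / 2) / Gamma α) *
        |μ.re| ^ ((Module.finrank ℝ V : ℝ) / 2 - α)) ^ α⁻¹) := by
  have hα0 : 0 < α := lt_of_le_of_lt (by positivity) hα
  have hκ : 0 < |μ.re| := abs_pos.2 hμ.ne
  have hG : 0 < Gamma α := Gamma_pos_of_pos hα0
  have hG' : 0 < Gamma (α - (Module.finrank ℝ V : ℝ) / 2) := Gamma_pos_of_pos (sub_pos.2 hα)
  rw [eLpNorm_eq_lintegral_rpow_enorm_toReal (by simpa using hα0) (by simp),
    ENNReal.toReal_ofReal hα0.le, one_div, ← ENNReal.ofReal_rpow_of_nonneg (by positivity)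
      (by positivity)]
  gcongr
  have h := lintegral_mul_sq_norm_add_rpow_neg (V := V) (c := (2 * π) ^ 2) (by positivity) hκ hα
  -- With `c = (2π)²` the Gaussian factor `π / c` is `1 / (4π)`, the source of `(4π) ^ (-n/2)`.
  rw [show π / (2 * π) ^ 2 = (4 * π)⁻¹ by field_simp; norm_num, inv_rpow (by positivity),
    ← rpow_neg (by positivity)] at h
  rw [← h]
  refine lintegral_mono fun ξ => ?_
  rw [← ofReal_norm, ENNReal.ofReal_rpow_of_nonneg (norm_nonneg _) hα0.le]
  refine ENNReal.ofReal_le_ofReal ?_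
  rw [rpow_neg (by positivity), ← inv_rpow (by positivity)]
  exact rpow_le_rpow (norm_nonneg _) (norm_resolventSymbol_le hμ ξ) hα0.le

theorem eLpNorm_top_resolventSymbol_le {μ : ℂ} (hμ : μ.re < 0) :
    eLpNorm (resolventSymbol V μ) ∞ volume ≤ ENNReal.ofReal |μ.re|⁻¹ := by
  have hκ : 0 < |μ.re| := abs_pos.2 hμ.ne
  rw [eLpNorm_exponent_top]
  refine eLpNormEssSup_le_of_ae_bound (Filter.Eventually.of_forall fun ξ => ?_)
  refine (norm_resolventSymbol_le hμ ξ).trans ?_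
  gcongr
  have : 0 ≤ (2 * π) ^ 2 * ‖ξ‖ ^ 2 := by positivity
  linarith

/-- Allows tempered distributions to be multiplied by the symbol. It is `x ↦ (c x - μ)⁻¹` composed
with `‖ξ‖ ^ 2`, and every derivative of the outer function is bounded away from the pole. -/
theorem hasTemperateGrowth_resolventSymbol {W : Type*} [NormedAddCommGroup W]
    [InnerProductSpace ℝ W] {μ : ℂ} (hμ : μ.re < 0) :
    (resolventSymbol W μ).HasTemperateGrowth := by
  set c : ℝ := (2 * π) ^ 2 with hc
  have hc0 : 0 < c := by positivity
  -- An open set containing `[0, ∞)` on which the denominator stays at least `|Re μ| / 2` in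
  -- modulus.
  set t : Set ℝ := {x | μ.re / 2 < c * x} with ht
  have hto : IsOpen t := isOpen_lt (by fun_prop) (by fun_prop)
  set g : ℝ → ℂ := fun x => ((c * x : ℝ) - μ)⁻¹ with hg
  have hlow : ∀ x ∈ t, -μ.re / 2 ≤ ‖((c * x : ℝ) : ℂ) - μ‖ := by
    intro x hx
    have h1 := le_norm_ofReal_sub μ (c * x)
    have h2 : μ.re / 2 < c * x := hx
    linarith
  have hne : ∀ x ∈ t, ((c * x : ℝ) : ℂ) - μ ≠ 0 := by
    intro x hx
    rw [← norm_pos_iff]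
    have := hlow x hx
    linarith
  have hder : ∀ n : ℕ, ∀ x ∈ t, iteratedDerivWithin n g t x =
      (-c : ℂ) ^ n * n.factorial * ((((c * x : ℝ) : ℂ) - μ) ^ (n + 1))⁻¹ := by
    intro n
    induction n with
    | zero => intro x hx; simp [hg]
    | succ n ih =>
      intro x hx
      rw [iteratedDerivWithin_succ, derivWithin_congr ih (ih x hx), derivWithin_of_isOpen hto hx]
      have h1 : HasDerivAt (fun x : ℝ => ((c * x : ℝ) : ℂ) - μ) c x := by
        have := ((hasDerivAt_id x).const_mul c).ofReal_comp
        simpa using this.sub_const μ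
      have h2 := ((h1.pow (n + 1)).inv (pow_ne_zero _ (hne x hx))).const_mul
        ((-c : ℂ) ^ n * n.factorial)
      refine h2.deriv.trans ?_
      have := hne x hx
      simp only [Pi.pow_apply, Nat.factorial_succ, Nat.add_sub_cancel]
      generalize ((c * x : ℝ) : ℂ) - μ = D at this ⊢
      push_cast
      field_simp
      ring
  have hcomp : resolventSymbol W μ = g ∘ fun ξ : W => ‖ξ‖ ^ 2 := rfl
  rw [hcomp]
  refine Function.HasTemperateGrowth.comp' (t := t) ?_ hto.uniqueDiffOn ?_ ?_
    (Function.hasTemperateGrowth_norm_sq W)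
  · rintro _ ⟨ξ, rfl⟩
    have : 0 ≤ c * ‖ξ‖ ^ 2 := by positivity
    change μ.re / 2 < c * ‖ξ‖ ^ 2
    linarith
  · refine ContDiffOn.inv (ContDiff.contDiffOn ?_) hne
    exact (Complex.ofRealCLM.contDiff.comp (contDiff_const.mul contDiff_id)).sub contDiff_const
  · intro N
    -- Summing the bounds for the separate orders gives one constant for all orders up to `N`.
    refine ⟨0, ∑ n ∈ Finset.range (N + 1), c ^ n * n.factorial * ((-μ.re / 2) ^ (n + 1))⁻¹,
      ?_, fun n hn x hx => ?_⟩
    · have : 0 < -μ.re / 2 := by linarith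
      positivity
    · have hpos : 0 < -μ.re / 2 := by linarith
      rw [norm_iteratedFDerivWithin_eq_norm_iteratedDerivWithin, hder n x hx, pow_zero, mul_one]
      refine le_trans ?_ (Finset.single_le_sum
        (f := fun n => c ^ n * n.factorial * ((-μ.re / 2) ^ (n + 1))⁻¹)
        (fun _ _ => by positivity) (Finset.mem_range.2 (Nat.lt_succ_of_le hn)))
      simp only [norm_mul, norm_pow, norm_neg, norm_inv, Complex.norm_real, Real.norm_eq_abs,
        abs_of_pos hc0, Complex.norm_natCast]
      gcongr
      exact hlow x hx

end ResolventSymbol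

/-! ### Solving the resolvent equation in tempered distributions -/

section ResolventEquation

open FourierTransform TemperedDistribution

variable {V : Type*} [NormedAddCommGroup V] [InnerProductSpace ℝ V] [FiniteDimensional ℝ V]
  [MeasurableSpace V] [BorelSpace V]

theorem fourier_laplacian_eq (U : 𝓢'(V, ℂ)) :
    𝓕 (Δ U) = -((2 * Real.pi) ^ 2 : ℂ) • smulLeftCLM ℂ (fun ξ : V => ((‖ξ‖ ^ 2 : ℝ) : ℂ)) (𝓕 U) := by
  rw [laplacian_eq_fourierMultiplierCLM, fourierMultiplierCLM_apply, ← Complex.coe_smul,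
    fourier_smul, fourier_fourierInv_eq]
  push_cast
  rfl

/-- The factor `4π²|ξ|² - μ` never vanishes and its inverse is an admissible multiplier, so it can
be divided out. No regularity of `μ` for the operator in `L_p` is involved. -/
theorem fourier_eq_smulLeftCLM_resolventSymbol {μ : ℂ} (hμ : μ.re < 0) {U W : 𝓢'(V, ℂ)}
    (h : -Δ U - μ • U = W) : 𝓕 U = smulLeftCLM ℂ (resolventSymbol V μ) (𝓕 W) := by
  set M : V → ℂ := ((2 * Real.pi) ^ 2 : ℂ) • (fun ξ : V => ((‖ξ‖ ^ 2 : ℝ) : ℂ)) - fun _ => μ with hM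
  have h1 : (fun ξ : V => ((‖ξ‖ ^ 2 : ℝ) : ℂ)).HasTemperateGrowth := by fun_prop
  have h2 : (((2 * Real.pi) ^ 2 : ℂ) • (fun ξ : V => ((‖ξ‖ ^ 2 : ℝ) : ℂ))).HasTemperateGrowth :=
    (Function.HasTemperateGrowth.const _).smul h1
  have h3 : (fun _ : V => μ).HasTemperateGrowth := by fun_prop
  have hMt : M.HasTemperateGrowth := h2.sub h3
  have hW : 𝓕 W = smulLeftCLM ℂ M (𝓕 U) := by
    rw [← h, hM, smulLeftCLM_sub h2 h3, smulLeftCLM_smul h1, sub_apply, smul_apply,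
      smulLeftCLM_const, sub_eq_add_neg, FourierTransform.fourier_add,
      FourierTransform.fourier_neg, FourierTransform.fourier_neg, FourierTransform.fourier_smul,
      fourier_laplacian_eq]
    module
  rw [hW, smulLeftCLM_smulLeftCLM_apply hMt (hasTemperateGrowth_resolventSymbol hμ)]
  have h1 : M * resolventSymbol V μ = fun _ => 1 := by
    ext ξ
    have h1 := le_norm_ofReal_sub μ ((2 * Real.pi) ^ 2 * ‖ξ‖ ^ 2)
    have h2 : ((((2 * Real.pi) ^ 2 * ‖ξ‖ ^ 2 : ℝ) : ℂ) - μ) ≠ 0 := by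
      rw [← norm_pos_iff]
      have : 0 ≤ (2 * Real.pi) ^ 2 * ‖ξ‖ ^ 2 := by positivity
      linarith
    have h3 : M ξ = (((2 * Real.pi) ^ 2 * ‖ξ‖ ^ 2 : ℝ) : ℂ) - μ := by
      simp [hM]
    rw [Pi.mul_apply, h3, resolventSymbol, mul_inv_cancel₀ h2]
  rw [h1, smulLeftCLM_const, one_smul]

/-- A solution `u` of `-Δ u - μ u = -w` is bounded in `L_e` in terms of the `L_t` norm of `w`. -/
theorem eLpNorm_le_of_resolvent_equation {p t t' A q e : ℝ≥0∞} [Fact (1 ≤ p)] [Fact (1 ≤ t)]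
    [Fact (1 ≤ t')] [Fact (1 ≤ q)] [Fact (1 ≤ e)]
    [t'.HolderConjugate t] [A.HolderTriple t' q] [e.HolderConjugate q]
    (ht : t ≤ 2) (hq : q ≤ 2) {μ : ℂ} (hμ : μ.re < 0)
    (hm : MemLp (resolventSymbol V μ) A volume)
    {u : Lp ℂ p (volume : Measure V)} {w : Lp ℂ t (volume : Measure V)}
    (h : -Δ (Lp.toTemperedDistribution u) - μ • Lp.toTemperedDistribution u =
      Lp.toTemperedDistribution w) :
    ∃ g : Lp ℂ e (volume : Measure V), u =ᵐ[volume] g ∧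
      ‖g‖ ≤ (eLpNorm (resolventSymbol V μ) A volume).toReal * ‖w‖ := by
  -- The chain of spaces is `L_t → L_t'` by the transform, `L_t' → L_q` by Hölder with the symbol,
  -- `L_q → L_e` by the inverse transform.
  obtain ⟨w', hw', hww'⟩ := exists_fourier_eq_toTemperedDistribution (q := t') ht w
  obtain ⟨g, hg, hgg⟩ := exists_fourierInv_eq_toTemperedDistribution (q := e) hq
    (hm.toLp _ • w' : Lp ℂ q (volume : Measure V))
  refine ⟨g, Lp.ae_eq_of_toTemperedDistribution_eq ?_, hg.trans ?_⟩
  · rw [← hgg, Lp.toTemperedDistribution_smul_eq (hasTemperateGrowth_resolventSymbol hμ), ← hww',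
      ← fourier_eq_smulLeftCLM_resolventSymbol hμ h, fourierInv_fourier_eq]
  · refine (Lp.norm_smul_le _ _).trans ?_
    rw [Lp.norm_toLp]
    gcongr

end ResolventEquation

/-! ### Graph calculus for unbounded operators -/

namespace Schrodinger

section Graphs

variable {E : Type*} [NormedAddCommGroup E] [NormedSpace ℂ E]

theorem mem_graph_add (S T : E →ₗ.[ℂ] E) (x y : E) :
    (x, y) ∈ (S + T).graph ↔ ∃ s t, (x, s) ∈ S.graph ∧ (x, t) ∈ T.graph ∧ y = s + t := by
  constructor
  · intro h
    obtain ⟨⟨w, hS, hT⟩, rfl, rfl⟩ := (LinearPMap.mem_graph_iff _).1 h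
    exact ⟨S ⟨w, hS⟩, T ⟨w, hT⟩, S.mem_graph ⟨w, hS⟩, T.mem_graph ⟨w, hT⟩, rfl⟩
  · rintro ⟨s, t, hs, ht, rfl⟩
    obtain ⟨⟨w, hS⟩, rfl, rfl⟩ := (LinearPMap.mem_graph_iff _).1 hs
    obtain ⟨⟨w', hT⟩, rfl : w' = w, rfl⟩ := (LinearPMap.mem_graph_iff _).1 ht
    exact (S + T).mem_graph ⟨w', hS, hT⟩

theorem mem_graph_sub (S T : E →ₗ.[ℂ] E) (x y : E) :
    (x, y) ∈ (S - T).graph ↔ ∃ s t, (x, s) ∈ S.graph ∧ (x, t) ∈ T.graph ∧ y = s - t := by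
  constructor
  · intro h
    obtain ⟨⟨w, hS, hT⟩, rfl, rfl⟩ := (LinearPMap.mem_graph_iff _).1 h
    exact ⟨S ⟨w, hS⟩, T ⟨w, hT⟩, S.mem_graph ⟨w, hS⟩, T.mem_graph ⟨w, hT⟩, rfl⟩
  · rintro ⟨s, t, hs, ht, rfl⟩
    obtain ⟨⟨w, hS⟩, rfl, rfl⟩ := (LinearPMap.mem_graph_iff _).1 hs
    obtain ⟨⟨w', hT⟩, rfl : w' = w, rfl⟩ := (LinearPMap.mem_graph_iff _).1 ht
    exact (S - T).mem_graph ⟨w', hS, hT⟩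

theorem mem_graph_scalarOp (z : ℂ) (x y : E) :
    (x, y) ∈ (scalarOp z : E →ₗ.[ℂ] E).graph ↔ y = z • x := by
  constructor
  · intro h
    obtain ⟨⟨w, hw⟩, rfl, rfl⟩ := (LinearPMap.mem_graph_iff _).1 h
    rfl
  · rintro rfl
    exact (scalarOp z : E →ₗ.[ℂ] E).mem_graph ⟨x, trivial⟩

theorem mem_graph_inverse {T : E →ₗ.[ℂ] E} (hT : LinearMap.ker T.toFun = ⊥) (x y : E) :
    (x, y) ∈ T.inverse.graph ↔ (y, x) ∈ T.graph := by
  rw [LinearPMap.inverse_graph hT]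
  simp

theorem ker_toFun_eq_bot_of_graph {T : E →ₗ.[ℂ] E} (h : ∀ x, (x, 0) ∈ T.graph → x = 0) :
    LinearMap.ker T.toFun = ⊥ := by
  refine LinearMap.ker_eq_bot'.2 fun x hx => Subtype.ext (h x ?_)
  have := T.mem_graph x
  rwa [show T x = 0 from hx] at this

theorem IsBijectiveOp.ker_eq_bot {T : E →ₗ.[ℂ] E} (hT : IsBijectiveOp T) :
    LinearMap.ker T.toFun = ⊥ :=
  LinearMap.ker_eq_bot.2 hT.1

theorem mem_graph_resolventOp {T : E →ₗ.[ℂ] E} {z : ℂ} (hz : IsRegularPoint T z) (f g : E) :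
    (f, g) ∈ (resolventOp T z).graph ↔ (g, f + z • g) ∈ T.graph := by
  rw [resolventOp, mem_graph_inverse hz.1.ker_eq_bot, mem_graph_sub]
  constructor
  · rintro ⟨s, t, hs, ht, rfl⟩
    rw [mem_graph_scalarOp] at ht
    simpa [ht] using hs
  · intro h
    exact ⟨_, _, h, (mem_graph_scalarOp _ _ _).2 rfl, by simp⟩

/-- Closability need not be assumed: by convention the closure of a nonclosable operator is the
operator itself. -/
theorem mem_closure_graph_of_mem_graph_closure {T : E →ₗ.[ℂ] E} {w : E × E}
    (h : w ∈ T.closure.graph) : w ∈ closure (T.graph : Set (E × E)) := by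
  by_cases hT : T.IsClosable
  · rwa [← hT.graph_closure_eq_closure_graph] at h
  · rw [LinearPMap.closure_def' hT] at h
    exact subset_closure h

theorem mem_of_mem_graph_closure {T : E →ₗ.[ℂ] E} {S : Set (E × E)} (hS : IsClosed S)
    (hT : ∀ x ∈ T.graph, x ∈ S) {w : E × E} (h : w ∈ T.closure.graph) : w ∈ S :=
  closure_minimal hT hS (mem_closure_graph_of_mem_graph_closure h)

theorem IsBoundedOp.tendsto {T : E →ₗ.[ℂ] E} (hT : IsBoundedOp T) {x y : ℕ → E} {x₀ y₀ : E}
    (hxy : ∀ k, (x k, y k) ∈ T.graph) (hxy₀ : (x₀, y₀) ∈ T.graph)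
    (hx : Filter.Tendsto x Filter.atTop (nhds x₀)) :
    Filter.Tendsto y Filter.atTop (nhds y₀) := by
  have hd : ∀ x, x ∈ T.domain := fun x => hT.1 ▸ trivial
  have hv : ∀ x y, (x, y) ∈ T.graph → T ⟨x, hd x⟩ = y := by
    intro x y h
    obtain ⟨w, rfl, rfl⟩ := (LinearPMap.mem_graph_iff _).1 h
    rfl
  have h1 : Filter.Tendsto (fun k => (⟨x k, hd _⟩ : T.domain)) Filter.atTop (nhds ⟨x₀, hd _⟩) :=
    tendsto_subtype_rng.2 hx
  have h2 := (hT.2.tendsto _).comp h1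
  simp only [Function.comp_def] at h2
  rw [hv _ _ hxy₀] at h2
  exact h2.congr fun k => hv _ _ (hxy k)

end Graphs

/-! ### The factorized resolvent and the eigenvalue equation -/

section Concrete

variable {n : ℕ} {p : ℝ≥0∞}

/-- Multiplication is a closed operator: convergence in `L_p` gives almost everywhere convergence
along a common subsequence. -/
theorem mem_graph_mulOp_of_tendsto [Fact (1 ≤ p)] {b : EuclideanSpace ℝ (Fin n) → ℂ}
    {u f : ℕ → LpRn n p} {u₀ f₀ : LpRn n p} (h : ∀ k, (u k, f k) ∈ (mulOp p b).graph)
    (hu : Filter.Tendsto u Filter.atTop (nhds u₀)) (hf : Filter.Tendsto f Filter.atTop (nhds f₀)) :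
    (u₀, f₀) ∈ (mulOp p b).graph := by
  rw [mem_graph_mulOp]
  simp only [mem_graph_mulOp] at h
  obtain ⟨φ, hφ, h1⟩ := (tendstoInMeasure_of_tendsto_Lp hu).exists_seq_tendsto_ae
  obtain ⟨ψ, hψ, h2⟩ := (tendstoInMeasure_of_tendsto_Lp
    (hf.comp hφ.tendsto_atTop)).exists_seq_tendsto_ae
  filter_upwards [h1, h2, ae_all_iff.2 h] with x hx1 hx2 hx3
  have h3 := (hx1.comp hψ.tendsto_atTop).const_mul (b x)
  refine tendsto_nhds_unique hx2 (h3.congr fun k => ?_)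
  simp [hx3]

variable [Fact (1 ≤ p)] {a b : EuclideanSpace ℝ (Fin n) → ℂ} {z : ℂ}

/-- This is `B [R A] = Q`. Along a sequence approximating `k` in the graph of `B R A`, the vectors
`R A k_j` converge because `[R A]` is bounded, and `B` is closed. -/
theorem mem_graph_mulOp_of_left_of_bordered (hz : IsAdmissible p a b z) {k w q : LpRn n p}
    (hw : (k, w) ∈ (leftOp p a z).graph) (hq : (k, q) ∈ (borderedOp p a b z).graph) :
    (w, q) ∈ (mulOp p b).graph := by
  obtain ⟨y, hy, hlim⟩ := mem_closure_iff_seq_limit.1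
    (mem_closure_graph_of_mem_graph_closure hq)
  have h : ∀ j, ∃ g, ((y j).1, g) ∈ (leftOp p a z).graph ∧ (g, (y j).2) ∈ (mulOp p b).graph := by
    intro j
    obtain ⟨c, hc, hcr⟩ := (mem_graph_prodOp _ _ _ _).1 (hy j)
    obtain ⟨g, hg, hgb⟩ := (mem_graph_prodOp _ _ _ _).1 hcr
    exact ⟨g, LinearPMap.le_graph_of_le (LinearPMap.le_closure _)
      ((mem_graph_prodOp _ _ _ _).2 ⟨c, hc, hg⟩), hgb⟩
  choose g hg hgb using h
  rw [Prod.tendsto_iff] at hlim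
  exact mem_graph_mulOp_of_tendsto hgb (hz.left.tendsto hg hw hlim.1) hlim.2

/-- With `v = (1 + Q)⁻¹ B g` and `w = [R A] v`, one gets `B u = B g - B w = (1 + Q) v - Q v = v`. -/
theorem mem_graph_perturbedResolvent (hz : IsAdmissible p a b z) {f u : LpRn n p}
    (h : (f, u) ∈ (perturbedResolvent p a b z).graph) :
    ∃ g v w, (f, g) ∈ (resolventOp (freeOp p) z).graph ∧ (v, w) ∈ (leftOp p a z).graph ∧
      u = g - w ∧ (u, v) ∈ (mulOp p b).graph := by
  obtain ⟨g, w, hg, hw, rfl⟩ := (mem_graph_sub _ _ _ _).1 h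
  obtain ⟨v, hv, hvw⟩ := (mem_graph_prodOp _ _ _ _).1 hw
  obtain ⟨c, hc, hcv⟩ := (mem_graph_prodOp _ _ _ _).1 hv
  refine ⟨g, v, w, hg, hvw, rfl, ?_⟩
  obtain ⟨g', hg', hgc⟩ := (mem_graph_prodOp _ _ _ _).1 hc
  obtain rfl : g' = g := LinearPMap.mem_graph_snd_inj _ hg' hg rfl
  rw [mem_graph_inverse hz.bijective.ker_eq_bot] at hcv
  obtain ⟨s, q, hs, hq, rfl⟩ := (mem_graph_add _ _ _ _).1 hcv
  rw [mem_graph_scalarOp, one_smul] at hs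
  subst hs
  have hwq := mem_graph_mulOp_of_left_of_bordered hz hvw hq
  have := (mulOp p b).graph.sub_mem hgc hwq
  simpa using this

/-- If `u = 0` then `v = B u = 0`, so `w = 0`, `g = 0` and `f = (H₀ - z) g = 0`. Injectivity is what
lets the graph of the inverse be read off in `IsSchrodingerOp`. -/
theorem ker_perturbedResolvent_eq_bot (hz : IsAdmissible p a b z) :
    LinearMap.ker (perturbedResolvent p a b z).toFun = ⊥ := by
  refine ker_toFun_eq_bot_of_graph fun f hf => ?_
  obtain ⟨g, v, w, hg, hw, h0, hb⟩ := mem_graph_perturbedResolvent hz hf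
  have hv : v = 0 := LinearPMap.mem_graph_snd_inj _ hb (Submodule.zero_mem _) rfl
  have hw0 : w = 0 := LinearPMap.mem_graph_snd_inj _ hw (Submodule.zero_mem _) hv
  have hg0 : g = 0 := by rw [hw0, sub_zero] at h0; exact h0.symm
  rw [mem_graph_resolventOp hz.regular, hg0, smul_zero, add_zero] at hg
  exact LinearPMap.mem_graph_snd_inj _ hg (Submodule.zero_mem _) rfl

theorem toDistr_equation_of_mem_graph_resolventOp (hz : IsRegularPoint (freeOp (n := n) p) z)
    {f g : LpRn n p} (h : (f, g) ∈ (resolventOp (freeOp p) z).graph) :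
    -Δ (toDistr p g) - z • toDistr p g = toDistr p f := by
  rw [mem_graph_resolventOp hz, mem_graph_freeOp] at h
  rw [← h.2, map_add, map_smul]
  abel

theorem continuous_toLp_smul {r t : ℝ≥0∞} [Fact (1 ≤ t)] [Fact (1 ≤ r)]
    [r.HolderTriple p t] (A : LpRn n r) : Continuous fun v : LpRn n p => (A • v : LpRn n t) :=
  ((ContinuousLinearMap.lsmul ℂ ℂ).holderL volume r p t A).continuous

theorem toDistr_eq_of_mem_graph_mulOp {r t : ℝ≥0∞} [Fact (1 ≤ t)] [r.HolderTriple p t]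
    (ha : MemLp a r volume) {v y : LpRn n p} (h : (v, y) ∈ (mulOp p a).graph) :
    toDistr p y = toDistr t (ha.toLp a • v : LpRn n t) := by
  rw [mem_graph_mulOp] at h
  ext φ
  change Lp.toTemperedDistribution y φ =
    Lp.toTemperedDistribution (ha.toLp a • v : LpRn n t) φ
  rw [Lp.toTemperedDistribution_apply, Lp.toTemperedDistribution_apply]
  refine integral_congr_ae ?_
  filter_upwards [h, Lp.coeFn_lpSMul (r := t) (ha.toLp a) v, ha.coeFn_toLp] with x h1 h2 h3
  rw [h1, h2, Pi.smul_apply', h3, smul_eq_mul (a x)]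

theorem isClosed_toDistr_equation {r t : ℝ≥0∞} [Fact (1 ≤ t)] [r.HolderTriple p t]
    [Fact (1 ≤ r)] (A : LpRn n r) (z : ℂ) :
    IsClosed {x : LpRn n p × LpRn n p | -Δ (toDistr p x.2) - z • toDistr p x.2 =
      toDistr t (A • x.1 : LpRn n t)} := by
  refine isClosed_eq ?_ ((toDistr t).continuous.comp
    ((continuous_toLp_smul A).comp continuous_fst))
  simp only [← TemperedDistribution.laplacianCLM_apply]
  fun_prop

/-- Even if `a v` is not in `L_p`, Hölder places it in `L_t`. In that form both sides of the
equation are continuous in `(v, w)`, so it passes from `R A` to its closure. -/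
theorem toDistr_equation_of_mem_graph_leftOp {r t : ℝ≥0∞} [Fact (1 ≤ t)] [r.HolderTriple p t]
    [Fact (1 ≤ r)]
    (hz : IsRegularPoint (freeOp (n := n) p) z) (ha : MemLp a r volume) {v w : LpRn n p}
    (h : (v, w) ∈ (leftOp p a z).graph) :
    -Δ (toDistr p w) - z • toDistr p w = toDistr t (ha.toLp a • v : LpRn n t) := by
  have hs : ∀ x ∈ (prodOp (resolventOp (freeOp p) z) (mulOp p a)).graph,
      x ∈ {x : LpRn n p × LpRn n p |
        -Δ (toDistr p x.2) - z • toDistr p x.2 = toDistr t (ha.toLp a • x.1 : LpRn n t)} := by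
    intro x hx
    obtain ⟨y, hy, hyw⟩ := (mem_graph_prodOp _ _ x.1 x.2).1 hx
    have h1 := toDistr_equation_of_mem_graph_resolventOp hz hyw
    have h2 := toDistr_eq_of_mem_graph_mulOp (t := t) ha hy
    rw [Set.mem_ofPred_eq, h1, h2]
  rw [leftOp] at h
  have h3 := mem_of_mem_graph_closure (isClosed_toDistr_equation (t := t) (ha.toLp a) z) hs h
  rwa [Set.mem_ofPred_eq] at h3

/-- An eigenfunction `u` of the perturbed operator lies in the domain of `B`, and
`(-Δ - μ) u = -a (b u)` in the sense of distributions. -/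
theorem IsSchrodingerOp.exists_eigenfunction {r t : ℝ≥0∞} [Fact (1 ≤ t)] [r.HolderTriple p t]
    [Fact (1 ≤ r)] (ha : MemLp a r volume) {H : LpRn n p →ₗ.[ℂ] LpRn n p}
    (hH : IsSchrodingerOp p a b H) {μ : ℂ} (hμ : IsEigenvalue H μ) :
    ∃ u v : LpRn n p, u ≠ 0 ∧ (v =ᵐ[volume] fun x => b x * u x) ∧
      -Δ (toDistr p u) - μ • toDistr p u = toDistr t (-(ha.toLp a • v : LpRn n t)) := by
  obtain ⟨z, hz, rfl⟩ := hH
  obtain ⟨u, hu0, hu⟩ := hμ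
  have h := LinearPMap.mem_graph _ u
  rw [hu] at h
  obtain ⟨f, y, hf, hy, he⟩ := (mem_graph_add _ _ _ _).1 h
  rw [mem_graph_scalarOp] at hy
  replace hf := (mem_graph_inverse (T := perturbedResolvent p a b z)
    (ker_perturbedResolvent_eq_bot hz) _ _).1 hf
  obtain ⟨g, v, w, hg, hw, h0, hb⟩ := mem_graph_perturbedResolvent hz hf
  refine ⟨u, v, hu0, (mem_graph_mulOp _ _ _ _).1 hb, ?_⟩
  have h1 := toDistr_equation_of_mem_graph_resolventOp hz.regular hg
  have h2 := toDistr_equation_of_mem_graph_leftOp (t := t) hz.regular ha hw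
  -- Here `(H - z) u = (μ - z) u`. Combined with `(-Δ - z) g = f`, `(-Δ - z) w = a v` and `u = g -
  -- w`, the auxiliary point `z` cancels.
  have hfu : f = μ • (u : LpRn n p) - z • (u : LpRn n p) := by rw [he, hy]; abel
  rw [hfu] at h1
  rw [map_neg, ← h2]
  have h3 : toDistr p (u : LpRn n p) = toDistr p g - toDistr p w := by rw [h0, map_sub]
  rw [map_sub, map_smul, map_smul, h3] at h1
  rw [h3]
  simp only [← TemperedDistribution.laplacianCLM_apply, map_sub] at h1 ⊢
  linear_combination (norm := module) h1

end Concrete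

/-! ### The bound for an eigenvalue -/

section EigenvalueBound

variable {n : ℕ} {p : ℝ≥0∞} [Fact (1 ≤ p)] {a b : EuclideanSpace ℝ (Fin n) → ℂ}

/-- If `μ` is an eigenvalue with negative real part, then the bound
`‖b‖_s ‖(4 π² |ξ|² - μ)⁻¹‖_A ‖a‖_r` for the norm of the bordered free resolvent at `μ` is at
least one. -/
theorem IsSchrodingerOp.one_le_of_isEigenvalue {r s t t' A q e : ℝ≥0∞} [Fact (1 ≤ r)]
    [Fact (1 ≤ t)] [Fact (1 ≤ t')] [Fact (1 ≤ q)] [Fact (1 ≤ e)]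
    [r.HolderTriple p t] [t'.HolderConjugate t] [A.HolderTriple t' q] [e.HolderConjugate q]
    [s.HolderTriple e p] (ht : t ≤ 2) (hq : q ≤ 2)
    (ha : MemLp a r volume) (hb : MemLp b s volume) {H : LpRn n p →ₗ.[ℂ] LpRn n p}
    (hH : IsSchrodingerOp p a b H) {μ : ℂ} (hμ : IsEigenvalue H μ) (hre : μ.re < 0)
    (hm : MemLp (resolventSymbol (EuclideanSpace ℝ (Fin n)) μ) A volume) :
    1 ≤ (eLpNorm (resolventSymbol (EuclideanSpace ℝ (Fin n)) μ) A volume).toReal *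
      ((eLpNorm a r volume).toReal * (eLpNorm b s volume).toReal) := by
  obtain ⟨u, v, hu0, hv, heq⟩ := hH.exists_eigenfunction (t := t) ha hμ
  obtain ⟨g, hug, hg⟩ := eLpNorm_le_of_resolvent_equation (t' := t') (A := A) (q := q) (e := e)
    ht hq hre hm heq
  set M := (eLpNorm (resolventSymbol (EuclideanSpace ℝ (Fin n)) μ) A volume).toReal
  have hav : ‖(ha.toLp a • v : LpRn n t)‖ ≤ (eLpNorm a r volume).toReal * ‖v‖ := by
    rw [← Lp.norm_toLp a ha]
    exact Lp.norm_smul_le _ _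
  have hgv : ‖g‖ ≤ M * ((eLpNorm a r volume).toReal * ‖v‖) := by
    rw [norm_neg] at hg
    exact hg.trans (by gcongr)
  have hvg : v = (hb.toLp b • g : LpRn n p) := by
    refine Lp.ext ?_
    filter_upwards [hv, hug, hb.coeFn_toLp, Lp.coeFn_lpSMul (r := p) (hb.toLp b) g]
      with x h1 h2 h3 h4
    rw [h1, h2, h4, Pi.smul_apply', h3, smul_eq_mul (b x)]
  have hvn : ‖v‖ ≤ (eLpNorm b s volume).toReal * ‖g‖ := by
    rw [← Lp.norm_toLp b hb]
    nth_rw 1 [hvg]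
    exact Lp.norm_smul_le _ _
  -- `g` equals `u` almost everywhere, so it is nonzero; by `hgv` neither is `v`, and `‖v‖` may be
  -- cancelled.
  have hg0 : ‖g‖ ≠ 0 := by
    intro h0
    rw [norm_eq_zero] at h0
    refine hu0 ((Lp.eq_zero_iff_ae_eq_zero).2 (hug.trans ?_))
    rw [h0]
    exact Lp.coeFn_zero _ _ _
  have hv0 : 0 < ‖v‖ := by
    refine (norm_nonneg v).lt_of_ne fun h0 => hg0 (le_antisymm ?_ (norm_nonneg g))
    rw [← h0] at hgv
    simpa using hgv
  refine le_of_mul_le_mul_right ?_ hv0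
  calc 1 * ‖v‖ ≤ (eLpNorm b s volume).toReal * ‖g‖ := by rw [one_mul]; exact hvn
    _ ≤ (eLpNorm b s volume).toReal * (M * ((eLpNorm a r volume).toReal * ‖v‖)) := by gcongr
    _ = _ := by ring

/-- Exponent bookkeeping in reciprocals, where `∞` is `0`. With `R, P, S` the reciprocals of `r, p,
s`: `hr₁` gives `t ≤ 2`, `hr₂` gives `1 ≤ t`, `hs₁` gives `q ≤ 2`, and `hs₂` makes `1/e = P - S`
nonnegative. -/
theorem IsSchrodingerOp.one_le_of_exponents (hp : 1 < p)
    {r s A : ℝ≥0∞} (hr : 0 < r) (hs : 0 < s)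
    (hr₁ : 2⁻¹ - p.toReal⁻¹ ≤ r.toReal⁻¹) (hr₂ : r.toReal⁻¹ ≤ 1 - p.toReal⁻¹)
    (hs₁ : -2⁻¹ + p.toReal⁻¹ ≤ s.toReal⁻¹) (hs₂ : s.toReal⁻¹ ≤ p.toReal⁻¹)
    (hA : A⁻¹ = r⁻¹ + s⁻¹)
    (ha : MemLp a r volume) (hb : MemLp b s volume) {H : LpRn n p →ₗ.[ℂ] LpRn n p}
    (hH : IsSchrodingerOp p a b H) {μ : ℂ} (hμ : IsEigenvalue H μ) (hre : μ.re < 0)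
    (hm : MemLp (resolventSymbol (EuclideanSpace ℝ (Fin n)) μ) A volume) :
    1 ≤ (eLpNorm (resolventSymbol (EuclideanSpace ℝ (Fin n)) μ) A volume).toReal *
      ((eLpNorm a r volume).toReal * (eLpNorm b s volume).toReal) := by
  have hinv : ∀ x : ℝ≥0∞, 0 < x → x⁻¹ = ENNReal.ofReal x.toReal⁻¹ := fun x hx => by
    rw [← ENNReal.toReal_inv, ENNReal.ofReal_toReal (ENNReal.inv_ne_top.2 hx.ne')]
  have h2 : (2 : ℝ≥0∞)⁻¹ = ENNReal.ofReal 2⁻¹ := by simp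
  have hP := hinv p (zero_lt_one.trans hp)
  have hR := hinv r hr
  have hS := hinv s hs
  have hR0 : 0 ≤ r.toReal⁻¹ := by positivity
  have hS0 : 0 ≤ s.toReal⁻¹ := by positivity
  have hP0 : 0 ≤ p.toReal⁻¹ := by positivity
  set P := p.toReal⁻¹
  set R := r.toReal⁻¹
  set S := s.toReal⁻¹
  have h1le : ∀ {x : ℝ≥0∞} {y : ℝ}, x⁻¹ = ENNReal.ofReal y → y ≤ 1 → 1 ≤ x := by
    intro x y hx hy
    rw [← ENNReal.inv_le_one, hx]
    exact ENNReal.ofReal_le_one.2 hy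
  have h2le : ∀ {x : ℝ≥0∞} {y : ℝ}, x⁻¹ = ENNReal.ofReal y → 2⁻¹ ≤ y → x ≤ 2 := by
    intro x y hx hy
    rw [← ENNReal.inv_le_inv, hx, h2]
    exact ENNReal.ofReal_le_ofReal hy
  have htrip : ∀ {x y z : ℝ≥0∞} {x' y' z' : ℝ}, x⁻¹ = ENNReal.ofReal x' →
      y⁻¹ = ENNReal.ofReal y' → z⁻¹ = ENNReal.ofReal z' → 0 ≤ x' → 0 ≤ y' → x' + y' = z' →
      x.HolderTriple y z := by
    intro x y z x' y' z' hx hy hz hx' hy' h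
    exact ⟨by rw [hx, hy, hz, ← ENNReal.ofReal_add hx' hy', h]⟩
  have hone : (1 : ℝ≥0∞)⁻¹ = ENNReal.ofReal 1 := by simp
  have hA' : A⁻¹ = ENNReal.ofReal (R + S) := by rw [hA, hR, hS, ENNReal.ofReal_add hR0 hS0]
  have ht := inv_inv (ENNReal.ofReal (R + P))
  have ht' := inv_inv (ENNReal.ofReal (1 - (R + P)))
  have he := inv_inv (ENNReal.ofReal (P - S))
  have hq := inv_inv (ENNReal.ofReal (1 - (P - S)))
  have : Fact (1 ≤ r) := ⟨h1le hR (by linarith)⟩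
  have : Fact (1 ≤ (ENNReal.ofReal (R + P))⁻¹) := ⟨h1le ht (by linarith)⟩
  have : Fact (1 ≤ (ENNReal.ofReal (1 - (R + P)))⁻¹) := ⟨h1le ht' (by linarith)⟩
  have : Fact (1 ≤ (ENNReal.ofReal (P - S))⁻¹) := ⟨h1le he (by linarith)⟩
  have : Fact (1 ≤ (ENNReal.ofReal (1 - (P - S)))⁻¹) := ⟨h1le hq (by linarith)⟩
  have := htrip hR hP ht hR0 hP0 rfl
  have : ENNReal.HolderConjugate _ _ :=
    htrip ht' ht hone (by linarith) (by linarith) (by ring)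
  have := htrip hA' ht' hq (by linarith) (by linarith) (by ring)
  have : ENNReal.HolderConjugate _ _ :=
    htrip he hq hone (by linarith) (by linarith) (by ring)
  have := htrip hS he hP hS0 (by linarith) (by ring)
  exact hH.one_le_of_isEigenvalue (t := (ENNReal.ofReal (R + P))⁻¹)
    (t' := (ENNReal.ofReal (1 - (R + P)))⁻¹) (q := (ENNReal.ofReal (1 - (P - S)))⁻¹)
    (e := (ENNReal.ofReal (P - S))⁻¹) (h2le ht (by linarith)) (h2le hq (by linarith)) ha hb hμ hre hm

end EigenvalueBound

end Schrodinger

/-! ### The explicit estimates -/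

theorem mainTheorem7 (n : ℕ) (hn : 1 ≤ n)
    (p : ℝ≥0∞) [Fact (1 ≤ p)] (hp : 1 < p) (hp' : p < ∞)
    (r s : ℝ≥0∞) (hr : 0 < r) (hs : 0 < s)
    (hr₁ : 2⁻¹ - p.toReal⁻¹ ≤ r.toReal⁻¹) (hr₂ : r.toReal⁻¹ ≤ 1 - p.toReal⁻¹)
    (hs₁ : -2⁻¹ + p.toReal⁻¹ ≤ s.toReal⁻¹) (hs₂ : s.toReal⁻¹ ≤ p.toReal⁻¹)
    (hrs : r.toReal⁻¹ + s.toReal⁻¹ < 2 / (n : ℝ))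
    (a b : EuclideanSpace ℝ (Fin n) → ℂ)
    (ha : MemLp a r volume) (hb : MemLp b s volume)
    (H : LpRn n p →ₗ.[ℂ] LpRn n p) (hH : Schrodinger.IsSchrodingerOp p a b H)
    (μ : ℂ) (hμ : Schrodinger.IsEigenvalue H μ) (hre : μ.re < 0) :
    (¬ (r = ∞ ∧ s = ∞) → ∀ α : ℝ, α = (r.toReal⁻¹ + s.toReal⁻¹)⁻¹ →
      |μ.re| ^ (α - (n : ℝ) / 2) ≤
        ((4 * Real.pi) ^ (-((n : ℝ) / 2)) * (Real.Gamma (α - (n : ℝ) / 2) / Real.Gamma α)) *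
          (eLpNorm a r volume).toReal ^ α * (eLpNorm b s volume).toReal ^ α) ∧
    (r = ∞ ∧ s = ∞ →
      |μ.re| ≤ (eLpNorm a ∞ volume).toReal * (eLpNorm b ∞ volume).toReal) := by
  have hκ : 0 < |μ.re| := abs_pos.2 hre.ne
  have hmeas := (continuous_resolventSymbol (W := EuclideanSpace ℝ (Fin n)) hre).aestronglyMeasurable
    (μ := (volume : Measure (EuclideanSpace ℝ (Fin n))))
  constructor
  · rintro hrs' α hα
    have hR0 : 0 ≤ r.toReal⁻¹ := by positivity
    have hS0 : 0 ≤ s.toReal⁻¹ := by positivity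
    have hpos : 0 < r.toReal⁻¹ + s.toReal⁻¹ := by
      rw [not_and_or] at hrs'
      rcases hrs' with h | h
      · have := inv_pos.2 (ENNReal.toReal_pos hr.ne' h)
        linarith
      · have := inv_pos.2 (ENNReal.toReal_pos hs.ne' h)
        linarith
    have hα0 : 0 < α := hα ▸ inv_pos.2 hpos
    -- The condition `1/r + 1/s < 2/n` is exactly what makes the symbol's `α`-th power integrable at
    -- infinity.
    have hnα : (n : ℝ) / 2 < α := by
      have hn0 : (0 : ℝ) < n := by exact_mod_cast hn
      rw [hα, lt_inv_comm₀ (by positivity) hpos, inv_div]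
      exact hrs
    have hA : (ENNReal.ofReal α)⁻¹ = r⁻¹ + s⁻¹ := by
      rw [← ENNReal.ofReal_inv_of_pos hα0, hα, inv_inv, ENNReal.ofReal_add hR0 hS0,
        ← ENNReal.toReal_inv, ← ENNReal.toReal_inv,
        ENNReal.ofReal_toReal (ENNReal.inv_ne_top.2 hr.ne'),
        ENNReal.ofReal_toReal (ENNReal.inv_ne_top.2 hs.ne')]
    have hbound := eLpNorm_resolventSymbol_le (V := EuclideanSpace ℝ (Fin n)) hre (α := α)
      (by simpa using hnα)
    rw [finrank_euclideanSpace_fin] at hbound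
    have key := hH.one_le_of_exponents hp hr hs hr₁ hr₂ hs₁ hs₂ hA ha hb hμ hre
      ⟨hmeas, hbound.trans_lt ENNReal.ofReal_lt_top⟩
    have hG : 0 < Real.Gamma α := Real.Gamma_pos_of_pos hα0
    have hG' : 0 < Real.Gamma (α - (n : ℝ) / 2) := Real.Gamma_pos_of_pos (sub_pos.2 hnα)
    set C := (4 * Real.pi) ^ (-((n : ℝ) / 2)) * (Real.Gamma (α - (n : ℝ) / 2) / Real.Gamma α)
    have hC : 0 < C := by positivity
    have hM := ENNReal.toReal_le_of_le_ofReal (by positivity) hbound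
    set x := (eLpNorm a r volume).toReal
    set y := (eLpNorm b s volume).toReal
    have hx : 0 ≤ x := ENNReal.toReal_nonneg
    have hy : 0 ≤ y := ENNReal.toReal_nonneg
    have h1 : 1 ≤ (C * |μ.re| ^ ((n : ℝ) / 2 - α)) ^ α⁻¹ * (x * y) := key.trans (by gcongr)
    -- Raising to the power `α` removes the root from the norm of the symbol.
    have h2 := Real.rpow_le_rpow zero_le_one h1 hα0.le
    rw [Real.one_rpow, Real.mul_rpow (by positivity) (by positivity),
      Real.rpow_inv_rpow (by positivity) hα0.ne', Real.mul_rpow hx hy] at h2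
    have h3 : |μ.re| ^ (α - (n : ℝ) / 2) * |μ.re| ^ ((n : ℝ) / 2 - α) = 1 := by
      rw [← Real.rpow_add hκ]
      simp
    calc |μ.re| ^ (α - (n : ℝ) / 2) = |μ.re| ^ (α - (n : ℝ) / 2) * 1 := (mul_one _).symm
      _ ≤ |μ.re| ^ (α - (n : ℝ) / 2) * (C * |μ.re| ^ ((n : ℝ) / 2 - α) * (x ^ α * y ^ α)) := by
        gcongr
      _ = (|μ.re| ^ (α - (n : ℝ) / 2) * |μ.re| ^ ((n : ℝ) / 2 - α)) * (C * x ^ α * y ^ α) := by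
        ring
      _ = C * x ^ α * y ^ α := by rw [h3, one_mul]
  · rintro ⟨rfl, rfl⟩
    have hbound := eLpNorm_top_resolventSymbol_le (V := EuclideanSpace ℝ (Fin n)) hre
    have key := hH.one_le_of_exponents hp hr hs hr₁ hr₂ hs₁ hs₂ (A := ∞) (by simp) ha hb hμ
      hre ⟨hmeas, hbound.trans_lt ENNReal.ofReal_lt_top⟩
    have hM := ENNReal.toReal_le_of_le_ofReal (by positivity) hbound
    have h1 : 1 ≤ |μ.re|⁻¹ * ((eLpNorm a ∞ volume).toReal * (eLpNorm b ∞ volume).toReal) :=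
      key.trans (by gcongr)
    rwa [inv_mul_eq_div, one_le_div hκ] at h1
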